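/- Let $\mathbb F$ be an algebraically closed field of characteristic $0$ and let $d\ge 0$ be an even integer. Write $\{A,B\}=AB+BA$. Let $\mathfrak{BI}$ be the universal Bannai–Ito algebra, i.e. the unital associative $\mathbb F$-algebra generated by $X,Y,Z$ subject to the relations that each of $$\kappa=\{X,Y\}-Z,\qquad \lambda=\{Y,Z\}-X,\qquad \mu=\{Z,X\}-Y$$ commutes with $X,Y,Z$. For $a,b,c\in\mathbb F$ put $$\theta_i=\frac{(-1)^i(2a-d+2i)}{2},\qquad \theta_i^*=\frac{(-1)^i(2b-d+2i)}{2}\qquad(0\le i\le d),$$ $$\varphi_i=\begin{cases}\dfrac{i(d+1-2i-2a-2b-2c)}{2} & i\text{ even},\\[2mm] \dfrac{(i-d-1)(d+1-2i-2a-2b+2c)}{2} & i\text{ odd}\end{cases}\qquad(1\le i\le d).$$ Let $O_d(a,b,c)$ be the $(d+1)$-dimensional $\mathfrak{BI}$-module with an $\mathbb F$-basis $v_0,\dots,v_d$ such that, with $v_{-1}=v_{d+1}=0$, $$Xv_i=\theta_iv_i+v_{i+1},\qquad Yv_i=\theta_i^*v_i+\varphi_iv_{i-1}\qquad (0\le i\le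 d)$$ (the term $\varphi_0v_{-1}$ being $0$), and on which $\kappa,\lambda,\mu$ act as the scalars $2ab-c(d+1)$, $2bc-a(d+1)$, $2ca-b(d+1)$ respectively (such a module exists and is unique up to isomorphism). Let $\mathbf{OM}_d$ be the set of isomorphism classes of irreducible $\mathfrak{BI}$-modules of dimension $d+1$, and let $\mathbf{OP}_d$ be the set of all $(a,b,c)\in\mathbb F^3$ such that $$a+b+c,\ \ a-b-c,\ \ -a+b-c,\ \ -a-b+c\ \notin\ \Bigl\{\tfrac{d+1}{2}-i \;\Big|\; i=2,4,\dots,d\Bigr\}.$$ Then for every $(a,b,c)\in\mathbf{OP}_d$ the module $O_d(a,b,c)$ is irreducible, and the map $$\mathbf{OP}_d\to\mathbf{OM}_d,\qquad (a,b,c)\mapsto\text{the isomorphism class of }O_d(a,b,c)$$ is a bijection. -/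

import Mathlib

universe u v

namespace BannaiIto

/-- The three generators of the universal Bannai–Ito algebra. -/
inductive Gen : Type
  | X
  | Y
  | Z

section Algebra

variable (F : Type u) [Field F]

/-- A generator, as an element of the free associative unital algebra on `X, Y, Z`. -/
abbrev gen (g : Gen) : FreeAlgebra F Gen := FreeAlgebra.ι F g

/-- The defining relations: each of `{X,Y} - Z`, `{Y,Z} - X`, `{Z,X} - Y` commutes with
each of the generators `X, Y, Z`, where `{A,B} = A B + B A`. -/
inductive Rel : FreeAlgebra F Gen → FreeAlgebra F Gen → Prop
  | kappa (g : Gen) :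
      Rel ((gen F .X * gen F .Y + gen F .Y * gen F .X - gen F .Z) * gen F g)
        (gen F g * (gen F .X * gen F .Y + gen F .Y * gen F .X - gen F .Z))
  | lambda (g : Gen) :
      Rel ((gen F .Y * gen F .Z + gen F .Z * gen F .Y - gen F .X) * gen F g)
        (gen F g * (gen F .Y * gen F .Z + gen F .Z * gen F .Y - gen F .X))
  | mu (g : Gen) :
      Rel ((gen F .Z * gen F .X + gen F .X * gen F .Z - gen F .Y) * gen F g)
        (gen F g * (gen F .Z * gen F .X + gen F .X * gen F .Z - gen F .Y))

/-- The universal Bannai–Ito algebra over `F`. -/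
abbrev BI : Type u := RingQuot (Rel F)

end Algebra

section OddModule

variable {F : Type u} [Field F]

/-- The diagonal entries `θ_i = (-1)^i (2a - d + 2i) / 2` (of `X` for the parameter `a`,
and of `Y` for the parameter `b`). -/
def theta (d : ℕ) (a : F) (i : ℕ) : F := (-1) ^ i * (2 * a - d + 2 * i) / 2

/-- The superdiagonal entries `φ_i` of `Y`. -/
def phi (d : ℕ) (a b c : F) (i : ℕ) : F :=
  if Even i then (i : F) * ((d : F) + 1 - 2 * i - 2 * a - 2 * b - 2 * c) / 2
  else ((i : F) - d - 1) * ((d : F) + 1 - 2 * i - 2 * a - 2 * b + 2 * c) / 2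

/-- The matrix of `X`: diagonal `θ_0, …, θ_d`, all subdiagonal entries `1`. -/
def matX (d : ℕ) (a : F) : Matrix (Fin (d + 1)) (Fin (d + 1)) F :=
  Matrix.of fun i j =>
    if (i : ℕ) = j then theta d a i else if (i : ℕ) = j + 1 then 1 else 0

/-- The matrix of `Y`: diagonal `θ*_0, …, θ*_d`, superdiagonal `φ_1, …, φ_d`. -/
def matY (d : ℕ) (a b c : F) : Matrix (Fin (d + 1)) (Fin (d + 1)) F :=
  Matrix.of fun i j =>
    if (i : ℕ) = j then theta d b i else if (j : ℕ) = i + 1 then phi d a b c j else 0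

/-- The matrix of `Z`, namely `{X,Y} - κ` with `κ = 2ab - c(d+1)`. -/
def matZ (d : ℕ) (a b c : F) : Matrix (Fin (d + 1)) (Fin (d + 1)) F :=
  matX d a * matY d a b c + matY d a b c * matX d a
    - Matrix.scalar (Fin (d + 1)) (2 * a * b - c * ((d : F) + 1))

/-- The matrices by which the generators act. -/
def matGen (d : ℕ) (a b c : F) : Gen → Matrix (Fin (d + 1)) (Fin (d + 1)) F
  | .X => matX d a
  | .Y => matY d a b c
  | .Z => matZ d a b c

/-- The `i`-th standard basis vector, zero when `i > d`. -/
def stdVec (F : Type u) [Field F] (d i : ℕ) : Fin (d + 1) → F :=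
  fun j => if (j : ℕ) = i then 1 else 0

theorem mulVec_stdVec (d : ℕ) (M : Matrix (Fin (d + 1)) (Fin (d + 1)) F) (j : Fin (d + 1)) :
    M.mulVec (stdVec F d j) = fun i => M i j := by
  have : stdVec F d j = Pi.single j 1 := by
    ext k
    simp [stdVec, Pi.single_apply, Fin.ext_iff]
  rw [this, Matrix.mulVec_single_one]
  rfl

theorem stdVec_eq_zero (d i : ℕ) (h : d < i) : stdVec F d i = 0 := by
  ext j
  have := j.2
  simp only [stdVec, Pi.zero_apply, ite_eq_right_iff]
  omega

theorem matX_mulVec (d : ℕ) (a : F) (i : ℕ) :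
    (matX d a).mulVec (stdVec F d i) = theta d a i • stdVec F d i + stdVec F d (i + 1) := by
  by_cases h : i < d + 1
  · have := mulVec_stdVec d (matX d a) ⟨i, h⟩
    simp only at this
    rw [this]
    ext k
    simp only [matX, Matrix.of_apply, stdVec, Pi.add_apply, Pi.smul_apply, smul_eq_mul]
    split_ifs <;> simp_all
  · rw [stdVec_eq_zero d i (by omega), stdVec_eq_zero d (i + 1) (by omega)]
    simp

theorem matY_mulVec_zero (d : ℕ) (a b c : F) :
    (matY d a b c).mulVec (stdVec F d 0) = theta d b 0 • stdVec F d 0 := by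
  have := mulVec_stdVec d (matY d a b c) ⟨0, by omega⟩
  simp only at this
  rw [this]
  ext k
  simp only [matY, Matrix.of_apply, stdVec, Pi.smul_apply, smul_eq_mul]
  split_ifs <;> simp_all

theorem matY_mulVec_succ (d : ℕ) (hd : Even d) (a b c : F) (i : ℕ) :
    (matY d a b c).mulVec (stdVec F d (i + 1))
      = theta d b (i + 1) • stdVec F d (i + 1) + phi d a b c (i + 1) • stdVec F d i := by
  rcases lt_trichotomy i d with h | h | h
  · have := mulVec_stdVec d (matY d a b c) ⟨i + 1, by omega⟩
    simp only at this
    rw [this]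
    ext k
    simp only [matY, Matrix.of_apply, stdVec, Pi.add_apply, Pi.smul_apply, smul_eq_mul]
    split_ifs <;> simp_all
  · subst h
    have hp : phi i a b c (i + 1) = 0 := by
      have : ¬ Even (i + 1) := by simpa [Nat.even_add_one] using hd
      simp [phi, this]
    rw [stdVec_eq_zero i (i + 1) (by omega), hp]
    simp
  · rw [stdVec_eq_zero d i (by omega), stdVec_eq_zero d (i + 1) (by omega)]
    simp

theorem mat_ext (d : ℕ) (M N : Matrix (Fin (d + 1)) (Fin (d + 1)) F)
    (h : ∀ i, M.mulVec (stdVec F d i) = N.mulVec (stdVec F d i)) : M = N := by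
  ext i j
  have := h j
  rw [mulVec_stdVec, mulVec_stdVec] at this
  exact congrFun this i

theorem matZ_mulVec (d : ℕ) (a b c : F) (v : Fin (d + 1) → F) :
    (matZ d a b c).mulVec v
      = (matX d a).mulVec ((matY d a b c).mulVec v) + (matY d a b c).mulVec ((matX d a).mulVec v)
        - (2 * a * b - c * ((d : F) + 1)) • v := by
  simp [matZ, Matrix.sub_mulVec, Matrix.add_mulVec, Matrix.mulVec_mulVec,
    ← Matrix.smul_one_eq_diagonal, Matrix.smul_mulVec]

/-- `κ` acts as `2ab - c(d+1)`. -/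
theorem mat_kappa (d : ℕ) (a b c : F) :
    matX d a * matY d a b c + matY d a b c * matX d a - matZ d a b c
      = Matrix.scalar (Fin (d + 1)) (2 * a * b - c * ((d : F) + 1)) := by
  simp [matZ]

/-- `λ` acts as `2bc - a(d+1)`. -/
theorem mat_lambda [CharZero F] (d : ℕ) (hd : Even d) (a b c : F) :
    matY d a b c * matZ d a b c + matZ d a b c * matY d a b c - matX d a
      = Matrix.scalar (Fin (d + 1)) (2 * b * c - a * ((d : F) + 1)) := by
  apply mat_ext
  intro i
  have hs : ∀ (r : F) (v : Fin (d + 1) → F),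
      (Matrix.scalar (Fin (d + 1)) r).mulVec v = r • v := by
    intro r v
    simp [← Matrix.smul_one_eq_diagonal, Matrix.smul_mulVec]
  rcases i with _ | _ | i
  · simp only [Matrix.sub_mulVec, Matrix.add_mulVec, ← Matrix.mulVec_mulVec, matZ_mulVec, hs,
      matX_mulVec, matY_mulVec_zero, matY_mulVec_succ d hd, Matrix.mulVec_add, Matrix.mulVec_sub,
      Matrix.mulVec_smul, zero_add]
    match_scalars <;> simp [theta, phi, Nat.even_add_one, pow_succ] <;> ring
  · simp only [Matrix.sub_mulVec, Matrix.add_mulVec, ← Matrix.mulVec_mulVec, matZ_mulVec, hs,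
      matX_mulVec, matY_mulVec_zero, matY_mulVec_succ d hd, Matrix.mulVec_add, Matrix.mulVec_sub,
      Matrix.mulVec_smul, zero_add]
    match_scalars <;> simp [theta, phi, Nat.even_add_one, pow_succ] <;> ring
  · simp only [Matrix.sub_mulVec, Matrix.add_mulVec, ← Matrix.mulVec_mulVec, matZ_mulVec, hs,
      matX_mulVec, matY_mulVec_succ d hd, Matrix.mulVec_add, Matrix.mulVec_sub,
      Matrix.mulVec_smul]
    rcases Nat.even_or_odd i with h | h
    · have h1 : (-1 : F) ^ i = 1 := h.neg_one_pow
      match_scalars <;> simp [theta, phi, Nat.even_add_one, pow_succ, h, h1] <;> ring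
    · have h1 : (-1 : F) ^ i = -1 := h.neg_one_pow
      have h2 : ¬ Even i := Nat.not_even_iff_odd.mpr h
      match_scalars <;> simp [theta, phi, Nat.even_add_one, pow_succ, h2, h1] <;> ring

/-- `μ` acts as `2ca - b(d+1)`. -/
theorem mat_mu [CharZero F] (d : ℕ) (hd : Even d) (a b c : F) :
    matZ d a b c * matX d a + matX d a * matZ d a b c - matY d a b c
      = Matrix.scalar (Fin (d + 1)) (2 * c * a - b * ((d : F) + 1)) := by
  apply mat_ext
  intro i
  have hs : ∀ (r : F) (v : Fin (d + 1) → F),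
      (Matrix.scalar (Fin (d + 1)) r).mulVec v = r • v := by
    intro r v
    simp [← Matrix.smul_one_eq_diagonal, Matrix.smul_mulVec]
  rcases i with _ | _ | i
  · simp only [Matrix.sub_mulVec, Matrix.add_mulVec, ← Matrix.mulVec_mulVec, matZ_mulVec, hs,
      matX_mulVec, matY_mulVec_zero, matY_mulVec_succ d hd, Matrix.mulVec_add, Matrix.mulVec_sub,
      Matrix.mulVec_smul, zero_add]
    match_scalars <;> simp [theta, phi, Nat.even_add_one, pow_succ] <;> ring
  · simp only [Matrix.sub_mulVec, Matrix.add_mulVec, ← Matrix.mulVec_mulVec, matZ_mulVec, hs,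
      matX_mulVec, matY_mulVec_succ d hd, Matrix.mulVec_add, Matrix.mulVec_sub,
      Matrix.mulVec_smul, zero_add]
    match_scalars <;> simp [theta, phi, Nat.even_add_one, pow_succ] <;> ring
  · simp only [Matrix.sub_mulVec, Matrix.add_mulVec, ← Matrix.mulVec_mulVec, matZ_mulVec, hs,
      matX_mulVec, matY_mulVec_succ d hd, Matrix.mulVec_add, Matrix.mulVec_sub,
      Matrix.mulVec_smul]
    rcases Nat.even_or_odd i with h | h
    · have h1 : (-1 : F) ^ i = 1 := h.neg_one_pow
      match_scalars <;> simp [theta, phi, Nat.even_add_one, pow_succ, h, h1] <;> ring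
    · have h1 : (-1 : F) ^ i = -1 := h.neg_one_pow
      have h2 : ¬ Even i := Nat.not_even_iff_odd.mpr h
      match_scalars <;> simp [theta, phi, Nat.even_add_one, pow_succ, h2, h1] <;> ring

theorem matGen_rel [CharZero F] (d : ℕ) (hd : Even d) (a b c : F)
    ⦃x y : FreeAlgebra F Gen⦄ (h : Rel F x y) :
    FreeAlgebra.lift F (matGen d a b c) x = FreeAlgebra.lift F (matGen d a b c) y := by
  have key : ∀ (r : F) (M : Matrix (Fin (d + 1)) (Fin (d + 1)) F),
      Matrix.scalar (Fin (d + 1)) r * M = M * Matrix.scalar (Fin (d + 1)) r := fun r M =>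
    Matrix.scalar_commute r (fun r' => Commute.all r r') M
  cases h with
  | kappa g =>
    simp only [gen, map_mul, map_sub, map_add, FreeAlgebra.lift_ι_apply]
    rw [show matGen d a b c .X = matX d a from rfl, show matGen d a b c .Y = matY d a b c from rfl,
      show matGen d a b c .Z = matZ d a b c from rfl, mat_kappa, key]
  | lambda g =>
    simp only [gen, map_mul, map_sub, map_add, FreeAlgebra.lift_ι_apply]
    rw [show matGen d a b c .X = matX d a from rfl, show matGen d a b c .Y = matY d a b c from rfl,
      show matGen d a b c .Z = matZ d a b c from rfl, mat_lambda d hd, key]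
  | mu g =>
    simp only [gen, map_mul, map_sub, map_add, FreeAlgebra.lift_ι_apply]
    rw [show matGen d a b c .X = matX d a from rfl, show matGen d a b c .Y = matY d a b c from rfl,
      show matGen d a b c .Z = matZ d a b c from rfl, mat_mu d hd, key]

/-- The matrix representation of the universal Bannai–Ito algebra that sends `X, Y, Z` to
`matX`, `matY`, `matZ`. -/
noncomputable def rep [CharZero F] (d : ℕ) (hd : Even d) (a b c : F) :
    BI F →ₐ[F] Matrix (Fin (d + 1)) (Fin (d + 1)) F :=
  RingQuot.liftAlgHom F ⟨FreeAlgebra.lift F (matGen d a b c), matGen_rel d hd a b c⟩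

/-- The underlying space `F^(d+1)` of the module `O_d(a,b,c)`. -/
def OddModule [CharZero F] (d : ℕ) (_hd : Even d) (_a _b _c : F) : Type u := Fin (d + 1) → F

noncomputable instance [CharZero F] (d : ℕ) (hd : Even d) (a b c : F) :
    AddCommGroup (OddModule d hd a b c) :=
  inferInstanceAs (AddCommGroup (Fin (d + 1) → F))

/-- An element of the algebra acts on column vectors through its matrix, so that the columns of
the matrix are the images of the standard basis vectors. -/
noncomputable instance [CharZero F] (d : ℕ) (hd : Even d) (a b c : F) :
    Module (BI F) (OddModule d hd a b c) :=
  Module.compHom (Fin (d + 1) → F)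
    (((Matrix.toLinAlgEquiv' (R := F) (n := Fin (d + 1))).toAlgHom.comp
      (rep d hd a b c)).toRingHom)

end OddModule

section Classes

variable (F : Type u) [Field F]

/-- The set of isomorphism classes of all modules (in the universe `max u v`) over the universal
Bannai–Ito algebra. -/
abbrev IsoClasses : Type (max u v + 1) :=
  Quotient (CategoryTheory.isIsomorphicSetoid (ModuleCat.{max u v} (BI F)))

/-- The isomorphism class of a module. -/
def isoClass (V : ModuleCat.{max u v} (BI F)) : IsoClasses.{u, v} F :=
  Quotient.mk (CategoryTheory.isIsomorphicSetoid (ModuleCat.{max u v} (BI F))) V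

/-- The dimension over `F` of a module over the universal Bannai–Ito algebra (zero if infinite). -/
noncomputable def dim (V : ModuleCat.{max u v} (BI F)) : ℕ :=
  @Module.finrank F V _ _ (Module.compHom V (algebraMap F (BI F)))

/-- The isomorphism classes of irreducible modules of dimension `d + 1`. -/
def OM (d : ℕ) : Set (IsoClasses.{u, v} F) :=
  {q | ∃ V : ModuleCat.{max u v} (BI F),
    IsSimpleModule (BI F) V ∧ dim.{u, v} F V = d + 1 ∧ q = isoClass.{u, v} F V}

/-- The set `{(d+1)/2 - i : i = 2, 4, …, d}`. -/
def excluded (d : ℕ) : Set F :=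
  {x | ∃ i : ℕ, Even i ∧ 2 ≤ i ∧ i ≤ d ∧ x = ((d : F) + 1) / 2 - i}

/-- The parameter set `OP_d`. -/
def OP (d : ℕ) : Set (F × F × F) :=
  {p | match p with
    | (a, b, c) =>
      a + b + c ∉ excluded F d ∧ a - b - c ∉ excluded F d ∧
      -a + b - c ∉ excluded F d ∧ -a - b + c ∉ excluded F d}

/-- The module `O_d(a,b,c)` as an object of the category of modules (in the universe
`max u v`). -/
noncomputable def oddObj [CharZero F] (d : ℕ) (hd : Even d) (a b c : F) :
    ModuleCat.{max u v} (BI F) :=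
  ModuleCat.of (BI F) (ULift.{v} (OddModule d hd a b c))

end Classes

end BannaiIto

/-! On an irreducible module κ, λ, μ and the Casimir X² + Y² + Z² are scalars. Put T = Y - 1/2 and S
= X + Z. Then TS + ST and T² + S² are scalars, so D = TS - ST anticommutes with T and with S. In odd
dimension, determinants force D to be singular. On its kernel T and S commute, so Y and X + Z have a
common eigenvector v (`exists_eigenvector`).

On v, Xv, X²v, … the operator Y is triangular with diagonal (-1)^i (y + i) (`Y_pow_mem`). The triple
(Y, -X, -Z) satisfies relations of the same kind and gives a second flag, spanned by powers of Y.
Irreducibility makes the two flags opposite (`krylov_inf_krylov_eq_bot`), and their intersections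
carry a basis in which X is lower and Y upper bidiagonal (`exists_split`). The cubic relation `YXX`
is then a second-order recurrence for the superdiagonal of Y; its two boundary zeros leave only φ_i
(`exists_equiv`). This is surjectivity. Injectivity holds because a = tr X, b = tr Y, and c is read
off from κ.

The conditions defining `OP` say that no φ_i(a,b,c) and no φ_i(a,-b,-c) vanishes. They are necessary
because a zero φ_i produces a submodule, and because negating Y and Z turns an irreducible
O_d(a,b,c) into O_d(a,-b,-c). They are sufficient because O_d(a,b,c) is then generated both by v_0
and by a common eigenvector of Y and X - Z. The trace of Y on a quotient, computed from each
generator, leaves only the quotient dimensions 0 and d + 1 (`isIrred_of_phi_ne_zero`). -/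

namespace BannaiIto

/-! ### Krylov subspaces of an operator. -/

section Krylov

variable {F : Type*} [Field F] {V : Type*} [AddCommGroup V] [Module F V]

/-- The span of `v, f v, …, f^(n-1) v`. -/
def krylov (f : Module.End F V) (v : V) (n : ℕ) : Submodule F V :=
  Submodule.span F ((fun j => (f ^ j) v) '' Set.Iio n)

theorem krylov_zero (f : Module.End F V) (v : V) : krylov f v 0 = ⊥ := by
  simp [krylov]

theorem krylov_succ (f : Module.End F V) (v : V) (n : ℕ) :
    krylov f v (n + 1) = krylov f v n ⊔ Submodule.span F {(f ^ n) v} := by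
  have h : Set.Iio (n + 1) = insert n (Set.Iio n) := by ext; simp
  rw [krylov, h, Set.image_insert_eq, Submodule.span_insert, sup_comm]
  rfl

theorem krylov_mono (f : Module.End F V) (v : V) : Monotone (krylov f v) := fun _ _ h =>
  Submodule.span_mono (Set.image_mono (Set.Iio_subset_Iio h))

theorem pow_mem_krylov (f : Module.End F V) (v : V) {i n : ℕ} (h : i < n) :
    (f ^ i) v ∈ krylov f v n :=
  Submodule.subset_span ⟨i, h, rfl⟩

theorem krylov_le {f : Module.End F V} {v : V} {n : ℕ} {W : Submodule F V}
    (h : ∀ i < n, (f ^ i) v ∈ W) : krylov f v n ≤ W := by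
  rw [krylov, Submodule.span_le]
  rintro _ ⟨i, hi, rfl⟩
  exact h i hi

theorem map_mem_krylov_succ (f : Module.End F V) (v : V) {n : ℕ} {w : V}
    (hw : w ∈ krylov f v n) : f w ∈ krylov f v (n + 1) := by
  have : krylov f v n ≤ (krylov f v (n + 1)).comap f := krylov_le fun i hi => by
    rw [Submodule.mem_comap, ← Module.End.mul_apply, ← pow_succ']
    exact pow_mem_krylov f v (by omega)
  exact this hw

theorem mem_krylov_succ_iff {f : Module.End F V} {v : V} {n : ℕ} {w : V} :
    w ∈ krylov f v (n + 1) ↔ ∃ x ∈ krylov f v n, ∃ r : F, w = x + r • (f ^ n) v := by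
  rw [krylov_succ, Submodule.mem_sup]
  simp only [Submodule.mem_span_singleton]
  constructor
  · rintro ⟨x, hx, _, ⟨r, rfl⟩, rfl⟩
    exact ⟨x, hx, r, rfl⟩
  · rintro ⟨x, hx, r, rfl⟩
    exact ⟨x, hx, _, ⟨r, rfl⟩, rfl⟩

/-- Cayley–Hamilton: the characteristic polynomial is monic of degree dim V. -/
theorem pow_finrank_mem_krylov [FiniteDimensional F V] (f : Module.End F V) (v : V) :
    (f ^ Module.finrank F V) v ∈ krylov f v (Module.finrank F V) := by
  have h := congrArg (fun g : Module.End F V => g v) (LinearMap.aeval_self_charpoly f)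
  simp only [LinearMap.zero_apply] at h
  rw [Polynomial.aeval_eq_sum_range, LinearMap.charpoly_natDegree, Finset.sum_range_succ,
    ← LinearMap.charpoly_natDegree f, Polynomial.coeff_natDegree, f.charpoly_monic.leadingCoeff,
    one_smul, LinearMap.add_apply, LinearMap.charpoly_natDegree, add_comm,
    add_eq_zero_iff_eq_neg] at h
  rw [h, LinearMap.sum_apply]
  refine Submodule.neg_mem _ (Submodule.sum_mem _ fun i hi => ?_)
  exact Submodule.smul_mem _ _ (pow_mem_krylov f v (Finset.mem_range.mp hi))

theorem map_mem_krylov_finrank [FiniteDimensional F V] (f : Module.End F V) (v : V) {w : V}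
    (hw : w ∈ krylov f v (Module.finrank F V)) : f w ∈ krylov f v (Module.finrank F V) := by
  obtain ⟨x, hx, r, h⟩ := mem_krylov_succ_iff.mp (map_mem_krylov_succ f v hw)
  rw [h]
  exact Submodule.add_mem _ hx (Submodule.smul_mem _ _ (pow_finrank_mem_krylov f v))

theorem finrank_krylov_le (f : Module.End F V) (v : V) (n : ℕ) :
    Module.finrank F (krylov f v n) ≤ n := by
  classical
  have h := finrank_span_finset_le_card (R := F) ((Finset.range n).image fun j => (f ^ j) v)
  have e : krylov f v n =
      Submodule.span F (((Finset.range n).image fun j => (f ^ j) v : Finset V) : Set V) := by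
    rw [krylov]; congr 1; ext; simp
  rw [e]
  exact h.trans (Finset.card_image_le.trans (by simp))

end Krylov

/-! ### Common eigenvectors in odd dimension. -/

section CommonEigenvector

variable {F : Type*} [Field F] {V : Type*} [AddCommGroup V] [Module F V]
  [FiniteDimensional F V]

theorem exists_eigenvector_mem [IsAlgClosed F] (f : Module.End F V) (E : Submodule F V) (hE : E ≠ ⊥)
    (hf : ∀ v ∈ E, f v ∈ E) : ∃ (r : F) (v : V), v ∈ E ∧ v ≠ 0 ∧ f v = r • v := by
  have : Nontrivial E := Submodule.nontrivial_iff_ne_bot.mpr hE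
  obtain ⟨r, hr⟩ := Module.End.exists_eigenvalue (f.restrict hf)
  obtain ⟨v, hv⟩ := hr.exists_hasEigenvector
  refine ⟨r, v, v.2, fun h => hv.2 (Subtype.ext h), ?_⟩
  simpa using congrArg Subtype.val hv.apply_eq_smul

/-- Taking determinants introduces the sign (-1)^dim = -1, so 2 · det D · det M = 0. -/
theorem det_eq_zero_of_anticomm [CharZero F] (hV : Odd (Module.finrank F V))
    {D M : Module.End F V} (hD : LinearMap.det D ≠ 0) (h : D * M = -(M * D)) :
    LinearMap.det M = 0 := by
  have h1 := congrArg LinearMap.det h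
  rw [← neg_one_smul F (M * D), LinearMap.det_smul, hV.neg_one_pow, map_mul, map_mul] at h1
  have : LinearMap.det D * (2 * LinearMap.det M) = 0 := by linear_combination h1
  simpa [hD] using this

/-- The commutator D anticommutes with T and S. If D were invertible, then T, T + S and T - S would
all be singular. But (T ± S)² = γ ± α are scalars, hence zero, so α = 0 and D = 2TS is singular
after all. -/
theorem exists_common_eigenvector [IsAlgClosed F] [CharZero F] (hV : Odd (Module.finrank F V))
    (T S : Module.End F V) (α γ : F) (h1 : ∀ v, T (S v) + S (T v) = α • v)
    (h2 : ∀ v, S (S v) + T (T v) = γ • v) :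
    ∃ (v : V) (t s : F), v ≠ 0 ∧ T v = t • v ∧ S v = s • v := by
  set D : Module.End F V := T * S - S * T with hD
  have e1 : T * S + S * T = α • 1 := LinearMap.ext h1
  have e2 : S * S + T * T = γ • 1 := LinearMap.ext h2
  have hDT : D * T = -(T * D) := by
    have : (T * S + S * T) * T = T * (T * S + S * T) := by rw [e1]; simp
    rw [hD]
    linear_combination (norm := noncomm_ring) -this
  have hDS : D * S = -(S * D) := by
    have : (T * S + S * T) * S = S * (T * S + S * T) := by rw [e1]; simp
    rw [hD]
    linear_combination (norm := noncomm_ring) this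
  have hdet : LinearMap.det D = 0 := by
    by_contra hne
    have hn : Module.finrank F V ≠ 0 := fun h => by simp [h] at hV
    have k1 : LinearMap.det (T + S) = 0 := det_eq_zero_of_anticomm hV hne (by
      linear_combination (norm := noncomm_ring) hDT + hDS)
    have k2 : LinearMap.det (T - S) = 0 := det_eq_zero_of_anticomm hV hne (by
      linear_combination (norm := noncomm_ring) hDT - hDS)
    have k3 : LinearMap.det T = 0 := det_eq_zero_of_anticomm hV hne hDT
    have q1 : (T + S) * (T + S) = (γ + α) • 1 := by
      rw [add_smul, ← e1, ← e2]; noncomm_ring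
    have q2 : (T - S) * (T - S) = (γ - α) • 1 := by
      rw [sub_smul, ← e1, ← e2]; noncomm_ring
    have d1 := congrArg LinearMap.det q1
    have d2 := congrArg LinearMap.det q2
    rw [map_mul, k1, LinearMap.det_smul, map_one, mul_one, mul_zero] at d1
    rw [map_mul, k2, LinearMap.det_smul, map_one, mul_one, mul_zero] at d2
    have d1' := pow_eq_zero_iff hn |>.mp d1.symm
    have d2' := pow_eq_zero_iff hn |>.mp d2.symm
    have hα : α = 0 := by
      have : (2 : F) * α = 0 := by linear_combination d1' - d2'
      simpa using this
    have : D = (2 : F) • (T * S) := by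
      rw [hα, zero_smul] at e1
      rw [two_smul, hD]
      linear_combination (norm := noncomm_ring) -e1
    rw [this, LinearMap.det_smul, map_mul, k3] at hne
    simp at hne
  -- Anticommutation makes ker D stable under T and S. There TS = ST, so S preserves the eigenspaces
  -- of T inside ker D.
  have hker : LinearMap.ker D ≠ ⊥ := (LinearMap.bot_lt_ker_of_det_eq_zero hdet).ne'
  obtain ⟨t, w, hw, hw0, hTw⟩ := exists_eigenvector_mem T (LinearMap.ker D) hker (fun v hv => by
    have := congrArg (fun g : Module.End F V => g v) hDT
    simp only [Module.End.mul_apply, LinearMap.neg_apply] at this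
    rw [LinearMap.mem_ker] at hv ⊢
    rw [this, hv, map_zero, neg_zero])
  obtain ⟨s, v, hv, hv0, hSv⟩ := exists_eigenvector_mem S
    (LinearMap.ker D ⊓ Module.End.eigenspace T t)
    (fun h => hw0 (by
      have : w ∈ LinearMap.ker D ⊓ Module.End.eigenspace T t :=
        ⟨hw, Module.End.mem_eigenspace_iff.mpr hTw⟩
      rwa [h, Submodule.mem_bot] at this))
    (fun v hv => by
      obtain ⟨hv1, hv2⟩ := hv
      rw [SetLike.mem_coe, LinearMap.mem_ker] at hv1
      rw [SetLike.mem_coe, Module.End.mem_eigenspace_iff] at hv2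
      refine ⟨?_, ?_⟩
      · have := congrArg (fun g : Module.End F V => g v) hDS
        simp only [Module.End.mul_apply, LinearMap.neg_apply] at this
        rw [SetLike.mem_coe, LinearMap.mem_ker, this, hv1, map_zero, neg_zero]
      · rw [SetLike.mem_coe, Module.End.mem_eigenspace_iff]
        simp only [hD, LinearMap.sub_apply, Module.End.mul_apply, hv2, map_smul, sub_eq_zero] at hv1
        exact hv1)
  exact ⟨v, t, s, hv0, Module.End.mem_eigenspace_iff.mp hv.2, hSv⟩

end CommonEigenvector

/-! ### Operators satisfying the Bannai–Ito relations with scalar κ, λ, μ. -/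

section Triple

variable {F : Type*} [Field F] {V : Type*} [AddCommGroup V] [Module F V]

/-- Operators `X, Y, Z` satisfying the Bannai–Ito relations with scalars `κ, l, m`. -/
structure IsTriple (X Y Z : Module.End F V) (κ l m : F) : Prop where
  kappa : ∀ v, X (Y v) + Y (X v) - Z v = κ • v
  lambda : ∀ v, Y (Z v) + Z (Y v) - X v = l • v
  mu : ∀ v, Z (X v) + X (Z v) - Y v = m • v

/-- Every subspace invariant under `X` and `Y` is trivial. -/
def IsIrred (X Y : Module.End F V) : Prop :=
  ∀ W : Submodule F V, (∀ w ∈ W, X w ∈ W) → (∀ w ∈ W, Y w ∈ W) → W = ⊥ ∨ W = ⊤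

/-- Every subspace invariant under `X` and `Y` and containing `v` is the whole space. -/
def Generates (X Y : Module.End F V) (v : V) : Prop :=
  ∀ W : Submodule F V, (∀ w ∈ W, X w ∈ W) → (∀ w ∈ W, Y w ∈ W) → v ∈ W → W = ⊤

theorem IsIrred.generates {X Y : Module.End F V} (h : IsIrred X Y) {v : V} (hv : v ≠ 0) :
    Generates X Y v := fun W hX hY hvW => (h W hX hY).resolve_left fun hW =>
  hv (by rwa [hW, Submodule.mem_bot] at hvW)

theorem IsIrred.swap {X Y : Module.End F V} (h : IsIrred X Y) : IsIrred Y X :=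
  fun W hX hY => h W hY hX

theorem IsIrred.neg_right {X Y : Module.End F V} (h : IsIrred X Y) : IsIrred X (-Y) :=
  fun W hX hY => h W hX fun w hw => by simpa using hY w hw

theorem Generates.neg_right {X Y : Module.End F V} {v : V} (h : Generates X Y v) :
    Generates X (-Y) v :=
  fun W hX hY => h W hX fun w hw => by simpa using hY w hw

namespace IsTriple

variable {X Y Z : Module.End F V} {κ l m : F}

/-- Once κ is a scalar, Z is redundant; this is why `IsIrred` and `Generates` involve X and Y only.
-/
theorem Z_apply (h : IsTriple X Y Z κ l m) (v : V) : Z v = X (Y v) + Y (X v) - κ • v := by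
  rw [← h.kappa v]; abel

theorem swap (h : IsTriple X Y Z κ l m) : IsTriple Y X Z κ m l where
  kappa v := by rw [← h.kappa v]; abel
  lambda v := by rw [← h.mu v]; abel
  mu v := by rw [← h.lambda v]; abel

/-- Combined with `swap`, this sends (X, Y, Z) to (Y, -X, -Z), the symmetry that produces the second
flag. -/
theorem neg (h : IsTriple X Y Z κ l m) : IsTriple X (-Y) (-Z) (-κ) l (-m) where
  kappa v := by simp only [LinearMap.neg_apply, map_neg, neg_smul]; rw [← h.kappa v]; abel
  lambda v := by simp only [LinearMap.neg_apply, map_neg]; rw [← h.lambda v]; abel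
  mu v := by simp only [LinearMap.neg_apply, map_neg, neg_smul]; rw [← h.mu v]; abel

theorem mapQ (h : IsTriple X Y Z κ l m) (W : Submodule F V) (hX : W ≤ W.comap X)
    (hY : W ≤ W.comap Y) (hZ : W ≤ W.comap Z) :
    IsTriple (W.mapQ W X hX) (W.mapQ W Y hY) (W.mapQ W Z hZ) κ l m where
  kappa v := by
    obtain ⟨v, rfl⟩ := W.mkQ_surjective v
    simp only [Submodule.mkQ_apply, Submodule.mapQ_apply, ← Submodule.Quotient.mk_add,
      ← Submodule.Quotient.mk_sub, ← Submodule.Quotient.mk_smul, h.kappa]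
  lambda v := by
    obtain ⟨v, rfl⟩ := W.mkQ_surjective v
    simp only [Submodule.mkQ_apply, Submodule.mapQ_apply, ← Submodule.Quotient.mk_add,
      ← Submodule.Quotient.mk_sub, ← Submodule.Quotient.mk_smul, h.lambda]
  mu v := by
    obtain ⟨v, rfl⟩ := W.mkQ_surjective v
    simp only [Submodule.mkQ_apply, Submodule.mapQ_apply, ← Submodule.Quotient.mk_add,
      ← Submodule.Quotient.mk_sub, ← Submodule.Quotient.mk_smul, h.mu]

/-- `X² Y + 2 X Y X + Y X² = Y + 2 κ X + μ`, solved for the last term. -/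
theorem YXX (h : IsTriple X Y Z κ l m) (v : V) :
    Y (X (X v)) = Y v + (2 * κ) • X v + m • v - X (X (Y v)) - (2 : F) • X (Y (X v)) := by
  have h1 := h.mu v
  rw [h.Z_apply (X v), h.Z_apply v] at h1
  simp only [map_add, map_sub, map_smul] at h1
  linear_combination (norm := module) h1

/-- The Casimir operator commutes with `X`. -/
theorem casimir_X (h : IsTriple X Y Z κ l m) (v : V) :
    X (X (X v)) + Y (Y (X v)) + Z (Z (X v)) = X (X (X v) + Y (Y v) + Z (Z v)) := by
  have k1 := h.kappa (Y v)
  have k2 := congrArg Y (h.kappa v)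
  have k3 := h.mu (Z v)
  have k4 := congrArg Z (h.mu v)
  simp only [map_add, map_sub, map_smul] at *
  linear_combination (norm := module) k2 - k1 + k4 - k3

theorem casimir_Y (h : IsTriple X Y Z κ l m) (v : V) :
    X (X (Y v)) + Y (Y (Y v)) + Z (Z (Y v)) = Y (X (X v) + Y (Y v) + Z (Z v)) := by
  have := h.swap.casimir_X v
  simp only [map_add] at *
  linear_combination (norm := module) this

/-- By `YXX`, the diagonal entries satisfy e_{i+2} = -e_i - 2e_{i+1}, which is solved by (-1)^i (y +
i). The eigenvector condition on X + Z is needed only for i = 1, where κ replaces YXv by Zv + κv -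
XYv. -/
theorem Y_pow_mem (h : IsTriple X Y Z κ l m) {v : V} {y s : F} (hy : Y v = y • v)
    (hs : X v + Z v = s • v) (i : ℕ) :
    Y ((X ^ i) v) - ((-1) ^ i * (y + i)) • (X ^ i) v ∈ krylov X v i := by
  induction i using Nat.twoStepInduction with
  | zero => simp [hy]
  | one =>
    have : Y (X v) - ((-1) ^ 1 * (y + (1 : ℕ))) • X v = (s + κ) • v := by
      have := h.kappa v
      rw [hy, map_smul] at this
      push_cast
      linear_combination (norm := module) this + hs
    rw [pow_one, this]
    exact Submodule.smul_mem _ _ (pow_mem_krylov X v (i := 0) (by omega))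
  | more i h0 h1 =>
    have e0 : (X ^ (i + 1)) v = X ((X ^ i) v) := by rw [pow_succ']; rfl
    have e1 : (X ^ (i + 2)) v = X (X ((X ^ i) v)) := by rw [pow_succ', pow_succ']; rfl
    set w := (X ^ i) v with hw
    rw [e0] at h1
    have m0 : w ∈ krylov X v (i + 2) := pow_mem_krylov X v (by omega)
    have m1 : X w ∈ krylov X v (i + 2) := e0 ▸ pow_mem_krylov X v (by omega)
    have n0 := krylov_mono X v (show i ≤ i + 2 by omega) h0
    have n2 := map_mem_krylov_succ X v (map_mem_krylov_succ X v h0)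
    have n1 := map_mem_krylov_succ X v h1
    rw [e1, h.YXX w]
    have key : Y w + (2 * κ) • X w + m • w - X (X (Y w)) - (2 : F) • X (Y (X w))
        - ((-1) ^ (i + 2) * (y + ((i + 2 : ℕ) : F))) • X (X w)
        = (Y w - ((-1) ^ i * (y + i)) • w) + ((-1) ^ i * (y + i)) • w
          + (2 * κ) • X w + m • w - X (X (Y w - ((-1) ^ i * (y + i)) • w))
          - (2 : F) • X (Y (X w) - ((-1) ^ (i + 1) * (y + ((i + 1 : ℕ) : F))) • X w) := by
      simp only [map_sub, map_smul]
      push_cast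
      module
    rw [key]
    refine Submodule.sub_mem _ (Submodule.sub_mem _ (Submodule.add_mem _ (Submodule.add_mem _
      (Submodule.add_mem _ n0 ?_) ?_) ?_) n2) ?_
    · exact Submodule.smul_mem _ _ m0
    · exact Submodule.smul_mem _ _ m1
    · exact Submodule.smul_mem _ _ m0
    · exact Submodule.smul_mem _ _ n1

theorem Y_mem_krylov (h : IsTriple X Y Z κ l m) {v : V} {y s : F} (hy : Y v = y • v)
    (hs : X v + Z v = s • v) (n : ℕ) {w : V} (hw : w ∈ krylov X v n) : Y w ∈ krylov X v n := by
  have : krylov X v n ≤ (krylov X v n).comap Y := krylov_le fun i hi => by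
    have := Submodule.add_mem _ (krylov_mono X v hi.le (h.Y_pow_mem hy hs i))
      (Submodule.smul_mem _ ((-1) ^ i * (y + i)) (pow_mem_krylov X v hi))
    rwa [sub_add_cancel] at this
  exact this hw

theorem Y_sub_mem_krylov (h : IsTriple X Y Z κ l m) {v : V} {y s : F} (hy : Y v = y • v)
    (hs : X v + Z v = s • v) (n : ℕ) {w : V} (hw : w ∈ krylov X v (n + 1)) :
    Y w - ((-1) ^ n * (y + n)) • w ∈ krylov X v n := by
  obtain ⟨x, hx, r, rfl⟩ := mem_krylov_succ_iff.mp hw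
  have := Submodule.add_mem _ (Submodule.sub_mem _ (h.Y_mem_krylov hy hs n hx)
    (Submodule.smul_mem _ ((-1) ^ n * (y + n)) hx))
    (Submodule.smul_mem _ r (h.Y_pow_mem hy hs n))
  convert this using 1
  simp only [map_add, map_smul]
  module

variable [FiniteDimensional F V]

theorem krylov_eq_top (h : IsTriple X Y Z κ l m) {v : V} {y s : F} (hy : Y v = y • v)
    (hs : X v + Z v = s • v) (hg : Generates X Y v) :
    krylov X v (Module.finrank F V) = ⊤ := by
  rcases Nat.eq_zero_or_pos (Module.finrank F V) with h0 | h0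
  · have := Module.finrank_zero_iff.mp h0
    exact Subsingleton.elim _ _
  · exact hg _ (fun w hw => map_mem_krylov_finrank X v hw)
      (fun w hw => h.Y_mem_krylov hy hs _ hw) (pow_mem_krylov X v (i := 0) h0)

/-- The vectors X^i v form a basis in which Y is triangular. Only generation by v is assumed, not
irreducibility, so this applies to quotients of unknown dimension. -/
theorem trace_Y (h : IsTriple X Y Z κ l m) {v : V} {y s : F} (hy : Y v = y • v)
    (hs : X v + Z v = s • v) (hg : Generates X Y v) :
    LinearMap.trace F V Y = ∑ i ∈ Finset.range (Module.finrank F V), (-1) ^ i * (y + (i : F)) := by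
  set n := Module.finrank F V with hn
  have htop : ⊤ ≤ Submodule.span F (Set.range fun i : Fin n => (X ^ (i : ℕ)) v) := by
    rw [← h.krylov_eq_top hy hs hg]
    exact krylov_le fun i hi => Submodule.subset_span ⟨⟨i, hi⟩, rfl⟩
  let e := basisOfTopLeSpanOfCardEqFinrank (fun i : Fin n => (X ^ (i : ℕ)) v) htop (by simp [hn])
  have he : ∀ i : Fin n, e i = (X ^ (i : ℕ)) v := fun i => by simp [e]
  rw [LinearMap.trace_eq_matrix_trace F e, Matrix.trace, Finset.sum_range]
  refine Finset.sum_congr rfl fun i _ => ?_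
  rw [Matrix.diag_apply, LinearMap.toMatrix_apply]
  have h0 : krylov X v i ≤ LinearMap.ker (e.coord i) := krylov_le fun j hj => by
    have : (X ^ j) v = e ⟨j, hj.trans i.2⟩ := by rw [he]
    rw [this, LinearMap.mem_ker, Module.Basis.coord_apply, Module.Basis.repr_self,
      Finsupp.single_eq_of_ne]
    exact fun hc => hj.ne' (congrArg Fin.val hc)
  have h1 := h0 (h.Y_pow_mem hy hs i)
  rw [LinearMap.mem_ker, map_sub, map_smul, ← he, sub_eq_zero, Module.Basis.coord_apply,
    Module.Basis.coord_apply, Module.Basis.repr_self] at h1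
  rw [h1]
  simp

/-- An irreducible triple on an odd-dimensional space has a common eigenvector of `Y` and
`X + Z`. -/
theorem exists_eigenvector [IsAlgClosed F] [CharZero F] (h : IsTriple X Y Z κ l m)
    (hirr : IsIrred X Y) (hV : Odd (Module.finrank F V)) :
    ∃ (v : V) (y s : F), v ≠ 0 ∧ Y v = y • v ∧ X v + Z v = s • v := by
  have hnt : Nontrivial V := Module.nontrivial_of_finrank_pos (R := F) hV.pos
  obtain ⟨ω, w, -, hw0, hw⟩ := exists_eigenvector_mem (X * X + Y * Y + Z * Z) ⊤ top_ne_bot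
    (fun _ _ => Submodule.mem_top)
  -- Schur's argument: an eigenspace of the Casimir is invariant under X and Y.
  have hΩ : ∀ v, X (X v) + Y (Y v) + Z (Z v) = ω • v := by
    have : Module.End.eigenspace (X * X + Y * Y + Z * Z) ω = ⊤ := by
      refine hirr.generates hw0 _ (fun v hv => ?_) (fun v hv => ?_)
        (Module.End.mem_eigenspace_iff.mpr hw) <;>
      rw [Module.End.mem_eigenspace_iff] at hv ⊢ <;>
      simp only [LinearMap.add_apply, Module.End.mul_apply] at hv ⊢
      · rw [h.casimir_X, hv, map_smul]
      · rw [h.casimir_Y, hv, map_smul]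
    intro v
    exact Module.End.mem_eigenspace_iff.mp (this ▸ Submodule.mem_top (x := v))
  -- The sum of the κ and λ relations is {Y, X + Z} - (X + Z) = κ + λ; the shift by 1/2 absorbs the
  -- linear term. Likewise (X + Z)² + (Y - 1/2)² is the Casimir plus μ + 1/4.
  obtain ⟨v, t, s, hv0, ht, hs⟩ := exists_common_eigenvector hV (Y - (1 / 2 : F) • 1) (X + Z)
    (κ + l) (ω + m + 1 / 4)
    (fun v => by
      have h1 := h.kappa v
      have h2 := h.lambda v
      simp only [LinearMap.sub_apply, LinearMap.add_apply, LinearMap.smul_apply,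
        Module.End.one_apply, map_add, map_sub, map_smul]
      linear_combination (norm := module) h1 + h2)
    (fun v => by
      have h1 := hΩ v
      have h2 := h.mu v
      simp only [LinearMap.sub_apply, LinearMap.add_apply, LinearMap.smul_apply,
        Module.End.one_apply, map_add, map_sub, map_smul]
      linear_combination (norm := module) h1 + h2)
  refine ⟨v, t + 1 / 2, s, hv0, ?_, hs⟩
  simp only [LinearMap.sub_apply, LinearMap.smul_apply, Module.End.one_apply] at ht
  linear_combination (norm := module) ht

end IsTriple

end Triple

/-! ### The recurrence that determines φ. -/

section Parameters

variable {F : Type*} [Field F]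

theorem theta_eq [CharZero F] (d : ℕ) (a : F) (i : ℕ) : theta d a i = (-1) ^ i * (a - d / 2 + i) := by
  rw [theta]; ring

/-- This is the coefficient of v_{i+1} in `YXX` applied to v_i, with κ = 2ab - c(d+1). -/
theorem phi_recurrence [CharZero F] (d : ℕ) (a b c : F) (i : ℕ) :
    phi d a b c i + 2 * phi d a b c (i + 1) + phi d a b c (i + 2)
      + (theta d b i + theta d b (i + 1)) * (theta d a i + theta d a (i + 1))
      + 2 * theta d a i * theta d b i + 2 * theta d a (i + 1) * theta d b (i + 1)
      = 2 * (2 * a * b - c * (d + 1)) := by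
  rcases Nat.even_or_odd i with h | h
  · have h1 : (-1 : F) ^ i = 1 := h.neg_one_pow
    simp [theta, phi, Nat.even_add_one, pow_succ, h, h1]
    ring
  · have h1 : (-1 : F) ^ i = -1 := h.neg_one_pow
    have h2 : ¬ Even i := Nat.not_even_iff_odd.mpr h
    simp [theta, phi, Nat.even_add_one, pow_succ, h1, h2]
    ring

theorem phi_zero (d : ℕ) (a b c : F) : phi d a b c 0 = 0 := by simp [phi]

theorem phi_last (d : ℕ) (hd : Even d) (a b c : F) : phi d a b c (d + 1) = 0 := by
  have : ¬ Even (d + 1) := by simpa [Nat.even_add_one] using hd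
  simp [phi, this]

/-- The characteristic polynomial is (t + 1)², so a solution starting at 0 is a multiple of (-1)^i
i, which in characteristic 0 cannot vanish again at d + 1 unless it is zero. -/
theorem eq_zero_of_recurrence [CharZero F] (δ : ℕ → F) (d : ℕ) (h0 : δ 0 = 0)
    (h : ∀ i < d, δ i + 2 * δ (i + 1) + δ (i + 2) = 0) (hlast : δ (d + 1) = 0) :
    ∀ i ≤ d + 1, δ i = 0 := by
  have key : ∀ i ≤ d + 1, δ i = (-1) ^ (i + 1) * i * δ 1 := by
    intro i
    induction i using Nat.twoStepInduction with
    | zero => simp [h0]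
    | one => simp
    | more i e0 e1 =>
      intro hi
      have := h i (by omega)
      rw [e0 (by omega), e1 (by omega)] at this
      push_cast at this ⊢
      rw [pow_succ, pow_succ, pow_succ] at *
      linear_combination this
  have h1 : δ 1 = 0 := by
    have := key (d + 1) le_rfl
    rw [hlast] at this
    have hne : ((d + 1 : ℕ) : F) ≠ 0 := Nat.cast_ne_zero.mpr (by omega)
    have hp : (-1 : F) ^ (d + 1 + 1) ≠ 0 := pow_ne_zero _ (neg_ne_zero.mpr one_ne_zero)
    exact (mul_eq_zero.mp this.symm).resolve_left (mul_ne_zero hp hne)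
  intro i hi
  rw [key i hi, h1, mul_zero]

end Parameters

/-! ### Opposite flags and the split basis. -/

section Split

variable {F : Type*} [Field F] {V : Type*} [AddCommGroup V] [Module F V]

namespace IsTriple

variable {X Y Z : Module.End F V} {κ l m : F}

/-- The flags of a standard pair of eigenvectors are in opposite position. -/
theorem krylov_inf_krylov_eq_bot (h : IsTriple X Y Z κ l m) (hirr : IsIrred X Y) {d : ℕ}
    (hV : Module.finrank F V = d + 1) {v w : V} {y s x t : F} (hy : Y v = y • v)
    (hs : X v + Z v = s • v) (hx : (-X) w = x • w) (ht : Y w + (-Z) w = t • w)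
    {i j : ℕ} (hij : i + j = d + 1) : krylov X v i ⊓ krylov Y w j = ⊥ := by
  -- Write V_i and U_j for the two flags. Modulo multiples of the given vector, X maps V_i ∩ U_j
  -- into V_{i+1} ∩ U_{j-1} and Y maps it into V_{i-1} ∩ U_{j+1}. So the sum over i + j = d + 1 is
  -- invariant.
  set W : Submodule F V :=
    ⨆ p : {p : ℕ × ℕ // p.1 + p.2 = d + 1}, krylov X v p.1.1 ⊓ krylov Y w p.1.2 with hW
  have hle : ∀ i j, i + j = d + 1 → krylov X v i ⊓ krylov Y w j ≤ W := fun i j hij =>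
    le_iSup (fun p : {p : ℕ × ℕ // p.1 + p.2 = d + 1} => krylov X v p.1.1 ⊓ krylov Y w p.1.2)
      ⟨(i, j), hij⟩
  have hWX : W ≤ W.comap X := by
    refine iSup_le ?_
    rintro ⟨⟨i, j⟩, hij⟩ u ⟨hu1, hu2⟩
    change i + j = d + 1 at hij
    change u ∈ krylov X v i at hu1
    change u ∈ krylov Y w j at hu2
    rcases j with _ | j
    · rw [krylov_zero, Submodule.mem_bot] at hu2
      rw [hu2]; exact Submodule.zero_mem _
    · have e : X u = -((-X) u - ((-1) ^ j * (x + j)) • u) - ((-1) ^ j * (x + j)) • u := by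
        rw [LinearMap.neg_apply]; module
      have k1 := Submodule.neg_mem _ (h.swap.neg.Y_sub_mem_krylov hx ht j hu2)
      have k2 := Submodule.add_mem _ (map_mem_krylov_succ X v hu1)
        (Submodule.smul_mem _ ((-1) ^ j * (x + j)) (krylov_mono X v (Nat.le_succ i) hu1))
      have k3 : -((-X) u - ((-1) ^ j * (x + j)) • u) ∈ W := by
        refine hle (i + 1) j (by omega) ⟨?_, k1⟩
        have e2 : -((-X) u - ((-1) ^ j * (x + j)) • u) = X u + ((-1) ^ j * (x + j)) • u := by
          rw [LinearMap.neg_apply]; module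
        exact e2 ▸ k2
      rw [Submodule.mem_comap, e]
      exact Submodule.sub_mem _ k3 (Submodule.smul_mem _ _ (hle i (j + 1) hij ⟨hu1, hu2⟩))
  have hWY : W ≤ W.comap Y := by
    refine iSup_le ?_
    rintro ⟨⟨i, j⟩, hij⟩ u ⟨hu1, hu2⟩
    change i + j = d + 1 at hij
    change u ∈ krylov X v i at hu1
    change u ∈ krylov Y w j at hu2
    rcases i with _ | i
    · rw [krylov_zero, Submodule.mem_bot] at hu1
      rw [hu1]; exact Submodule.zero_mem _
    · have e : Y u = (Y u - ((-1) ^ i * (y + i)) • u) + ((-1) ^ i * (y + i)) • u := by abel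
      have k1 := h.Y_sub_mem_krylov hy hs i hu1
      have k2 := Submodule.sub_mem _ (map_mem_krylov_succ Y w hu2)
        (Submodule.smul_mem _ ((-1) ^ i * (y + i)) (krylov_mono Y w (Nat.le_succ j) hu2))
      rw [Submodule.mem_comap, e]
      exact Submodule.add_mem _ (hle i (j + 1) (by omega) ⟨k1, k2⟩)
        (Submodule.smul_mem _ _ (hle (i + 1) j hij ⟨hu1, hu2⟩))
  -- Since U_0 = 0, only pieces with i ≤ d contribute; hence dim W ≤ d and W is not the whole space.
  have hWd : W ≤ krylov X v d := by
    refine iSup_le ?_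
    rintro ⟨⟨i, j⟩, hij⟩ u ⟨hu1, hu2⟩
    change i + j = d + 1 at hij
    change u ∈ krylov X v i at hu1
    change u ∈ krylov Y w j at hu2
    rcases j with _ | j
    · rw [krylov_zero, Submodule.mem_bot] at hu2
      rw [hu2]; exact Submodule.zero_mem _
    · exact krylov_mono X v (by omega) hu1
  rcases hirr W (fun u hu => hWX hu) (fun u hu => hWY hu) with hbot | htop
  · exact le_bot_iff.mp (hbot ▸ hle i j hij)
  · have h1 : krylov X v d = ⊤ := top_le_iff.mp (htop ▸ hWd)
    have h2 := finrank_krylov_le X v d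
    rw [h1, finrank_top, hV] at h2
    omega

variable [FiniteDimensional F V]

/-- The basis is u_i = (X - θ_{i-1}) ⋯ (X - θ_0) v, where each factor climbs one step in the flag of
v and descends one step in the flag of w. Thus u_i lies in V_{i+1} ∩ U_{d+1-i}. -/
theorem exists_split [IsAlgClosed F] [CharZero F] (h : IsTriple X Y Z κ l m)
    (hirr : IsIrred X Y) {d : ℕ} (hd : Even d) (hV : Module.finrank F V = d + 1) :
    ∃ (a b : F) (u : ℕ → V) (ψ : ℕ → F),
      (∀ i, X (u i) = theta d a i • u i + u (i + 1)) ∧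
      Y (u 0) = theta d b 0 • u 0 ∧
      (∀ i, Y (u (i + 1)) = theta d b (i + 1) • u (i + 1) + ψ i • u i) ∧
      (∀ i, d < i → u i = 0) ∧ (∀ i, d ≤ i → ψ i = 0) ∧
      ⊤ ≤ Submodule.span F (Set.range fun i : Fin (d + 1) => u i) := by
  have hodd : Odd (Module.finrank F V) := hV ▸ hd.add_one
  obtain ⟨v, y, s, hv0, hy, hs⟩ := h.exists_eigenvector hirr hodd
  obtain ⟨w, x, t, hw0, hx, ht⟩ := h.swap.neg.exists_eigenvector hirr.swap.neg_right hodd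
  have hVtop : krylov X v (d + 1) = ⊤ := hV ▸ h.krylov_eq_top hy hs (hirr.generates hv0)
  have hUtop : krylov Y w (d + 1) = ⊤ :=
    hV ▸ h.swap.neg.krylov_eq_top hx ht (hirr.swap.neg_right.generates hw0)
  have hbot : ∀ {i j : ℕ}, i + j = d + 1 → krylov X v i ⊓ krylov Y w j = ⊥ := fun hij =>
    h.krylov_inf_krylov_eq_bot hirr hV hy hs hx ht hij
  -- The parameters are fixed by the ends of the diagonals: θ_d = -x is the eigenvalue of X on w,
  -- and θ*_0 = y that of Y on v.
  set a : F := -x - d / 2 with ha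
  set b : F := y + d / 2 with hb
  have hθb : ∀ i, theta d b i = (-1) ^ i * (y + i) := fun i => by rw [theta_eq, hb]; ring
  have hθa : ∀ i j, i + j = d → theta d a i = -((-1) ^ j * (x + j)) := fun i j hij => by
    have e : (-1 : F) ^ i = (-1) ^ j := by
      have : (-1 : F) ^ i * (-1) ^ j = 1 := by rw [← pow_add, hij, hd.neg_one_pow]
      rcases neg_one_pow_eq_or F i with h1 | h1 <;> rcases neg_one_pow_eq_or F j with h2 | h2 <;>
        rw [h1, h2] at this ⊢ <;> norm_num at this
    rw [theta_eq, ha, e, ← hij]; push_cast; ring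
  let u : ℕ → V := fun i => Nat.rec v (fun i u => X u - theta d a i • u) i
  have hu0 : u 0 = v := rfl
  have hus : ∀ i, u (i + 1) = X (u i) - theta d a i • u i := fun _ => rfl
  have huV : ∀ i, u i - (X ^ i) v ∈ krylov X v i := by
    intro i
    induction i with
    | zero => simp [hu0]
    | succ i ih =>
      have h1 := map_mem_krylov_succ X v ih
      have h2 : u i ∈ krylov X v (i + 1) := by
        have := Submodule.add_mem _ (krylov_mono X v (Nat.le_succ i) ih)
          (pow_mem_krylov X v (Nat.lt_succ_self i))
        rwa [sub_add_cancel] at this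
      have := Submodule.sub_mem _ h1 (Submodule.smul_mem _ (theta d a i) h2)
      convert this using 1
      rw [hus, map_sub, pow_succ']
      simp only [Module.End.mul_apply]
      abel
  have huV' : ∀ i, u i ∈ krylov X v (i + 1) := fun i => by
    have := Submodule.add_mem _ (krylov_mono X v (Nat.le_succ i) (huV i))
      (pow_mem_krylov X v (Nat.lt_succ_self i))
    rwa [sub_add_cancel] at this
  have huU : ∀ i j, i + j = d + 1 → u i ∈ krylov Y w j := by
    intro i
    induction i with
    | zero =>
      intro j hj
      rw [show j = d + 1 by omega, hUtop]
      exact Submodule.mem_top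
    | succ i ih =>
      intro j hj
      have := Submodule.neg_mem _
        (h.swap.neg.Y_sub_mem_krylov hx ht j (ih (j + 1) (by omega)))
      convert this using 1
      rw [hus, hθa i j (by omega), LinearMap.neg_apply]
      module
  have hmem : ∀ i (z : V), z ∈ krylov X v (i + 1) → ∃ r : F, z - r • u i ∈ krylov X v i := by
    intro i z hz
    obtain ⟨x, hx, r, rfl⟩ := mem_krylov_succ_iff.mp hz
    refine ⟨r, ?_⟩
    have := Submodule.sub_mem _ hx (Submodule.smul_mem _ r (huV i))
    convert this using 1
    module
  have hspan : ∀ i, krylov X v i ≤ Submodule.span F (u '' Set.Iio i) := by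
    intro i
    induction i with
    | zero => rw [krylov_zero]; exact bot_le
    | succ i ih =>
      intro z hz
      obtain ⟨r, hr⟩ := hmem i z hz
      have h1 := Submodule.span_mono (R := F) (Set.image_mono (f := u)
        (Set.Iio_subset_Iio (Nat.le_succ i))) (ih hr)
      have h2 : u i ∈ Submodule.span F (u '' Set.Iio (i + 1)) :=
        Submodule.subset_span ⟨i, Nat.lt_succ_self i, rfl⟩
      have := Submodule.add_mem _ h1 (Submodule.smul_mem _ r h2)
      rwa [sub_add_cancel] at this
  have hlast : ∀ i, d < i → u i = 0 := by
    intro i hi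
    induction i, hi using Nat.le_induction with
    | base => simpa [krylov_zero] using huU (d + 1) 0 rfl
    | succ i hi ih => rw [hus, ih]; simp
  have hY : ∀ i, ∃ r : F, Y (u (i + 1)) = theta d b (i + 1) • u (i + 1) + r • u i ∧
      (d ≤ i → r = 0) := by
    intro i
    rcases Nat.lt_or_ge i d with hi | hi
    -- Here z lies in V_{i+1} ∩ U_{d-i+1}. Removing its u_i component leaves an element of V_i ∩
    -- U_{d-i+1}, which is zero since the indices add up to d + 1.
    · set z := Y (u (i + 1)) - theta d b (i + 1) • u (i + 1) with hz
      have hzV : z ∈ krylov X v (i + 1) := by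
        rw [hz, hθb]
        exact h.Y_sub_mem_krylov hy hs (i + 1) (huV' (i + 1))
      have hzU : z ∈ krylov Y w (d - i + 1) :=
        Submodule.sub_mem _ (map_mem_krylov_succ Y w (huU (i + 1) (d - i) (by omega)))
          (Submodule.smul_mem _ _ (krylov_mono Y w (Nat.le_succ _) (huU (i + 1) (d - i) (by omega))))
      obtain ⟨r, hr⟩ := hmem i z hzV
      have hr' : z - r • u i ∈ krylov X v i ⊓ krylov Y w (d - i + 1) :=
        ⟨hr, Submodule.sub_mem _ hzU (Submodule.smul_mem _ _ (huU i _ (by omega)))⟩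
      rw [hbot (by omega), Submodule.mem_bot, hz] at hr'
      refine ⟨r, ?_, fun hc => absurd hc (by omega)⟩
      linear_combination (norm := module) hr'
    · refine ⟨0, ?_, fun _ => rfl⟩
      rw [hlast (i + 1) (by omega)]
      simp
  choose ψ hψ hψ0 using hY
  refine ⟨a, b, u, ψ, fun i => by rw [hus]; abel, by rw [hu0, hy, hθb]; simp, hψ, hlast, hψ0, ?_⟩
  rw [← hVtop]
  refine (hspan (d + 1)).trans (Submodule.span_mono ?_)
  rintro _ ⟨i, hi, rfl⟩
  exact ⟨⟨i, hi⟩, rfl⟩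

/-- An irreducible triple on a space of odd dimension is given by the matrices of some
`O_d(a,b,c)`. -/
theorem exists_equiv [IsAlgClosed F] [CharZero F] (h : IsTriple X Y Z κ l m)
    (hirr : IsIrred X Y) {d : ℕ} (hd : Even d) (hV : Module.finrank F V = d + 1) :
    ∃ (a b c : F) (E : (Fin (d + 1) → F) ≃ₗ[F] V), κ = 2 * a * b - c * (d + 1) ∧
      (∀ x, E ((matX d a).mulVec x) = X (E x)) ∧ (∀ x, E ((matY d a b c).mulVec x) = Y (E x)) := by
  obtain ⟨a, b, u, ψ, hX, hY0, hY, hu, hψ, hspan⟩ := h.exists_split hirr hd hV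
  let e := basisOfTopLeSpanOfCardEqFinrank (fun i : Fin (d + 1) => u i) hspan (by simp [hV])
  have he : ∀ i : Fin (d + 1), e i = u i := fun i => by simp [e]
  have hc : ((d : F) + 1) ≠ 0 := Nat.cast_add_one_ne_zero d
  -- With a and b known, c is forced by the value of κ.
  set c : F := (2 * a * b - κ) / (d + 1) with hcdef
  have hκ : κ = 2 * a * b - c * (d + 1) := by rw [hcdef]; field_simp; ring
  have hcoord : ∀ (k : Fin (d + 1)) (j : ℕ), e.coord k (u j) = if j = k then 1 else 0 := by
    intro k j
    rcases Nat.lt_or_ge j (d + 1) with hj | hj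
    · rw [show u j = e ⟨j, hj⟩ by rw [he], Module.Basis.coord_apply, Module.Basis.repr_self,
        Finsupp.single_apply]
      simp [Fin.ext_iff]
    · rw [hu j (by omega), map_zero, if_neg (by omega)]
  -- Shifting the index and setting φ_0 = 0 supplies the left boundary zero; the right one is ψ_d =
  -- 0.
  set φ : ℕ → F := fun i => Nat.casesOn i 0 ψ with hφ
  have hφs : ∀ i, φ (i + 1) = ψ i := fun _ => rfl
  have hrec : ∀ i < d, φ i + 2 * φ (i + 1) + φ (i + 2)
      + (theta d b i + theta d b (i + 1)) * (theta d a i + theta d a (i + 1))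
      + 2 * theta d a i * theta d b i + 2 * theta d a (i + 1) * theta d b (i + 1) = 2 * κ := by
    intro i hi
    have key := congrArg (e.coord ⟨i + 1, by omega⟩) (h.YXX (u i))
    rcases i with _ | i
    · simp only [hX, hY, hY0, map_add, map_sub, map_smul, hcoord, smul_eq_mul, zero_add] at key
      simp [hφ] at key ⊢
      linear_combination key
    · simp only [hX, hY, map_add, map_sub, map_smul, hcoord, smul_eq_mul] at key
      simp [hφ, show ¬ i = i + 1 + 1 by omega] at key ⊢
      linear_combination key
  have hphi : ∀ i ≤ d + 1, φ i = phi d a b c i := by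
    have := eq_zero_of_recurrence (fun i => φ i - phi d a b c i) d (by simp [hφ, phi_zero])
      (fun i hi => by
        have h1 := hrec i hi
        have h2 := phi_recurrence d a b c i
        linear_combination h1 - h2 + 2 * hκ)
      (by rw [hφs, hψ d le_rfl, phi_last d hd, sub_zero])
    exact fun i hi => sub_eq_zero.mp (this i hi)
  have hE : ∀ i, e.equivFun.symm (stdVec F d i) = u i := by
    intro i
    rcases Nat.lt_or_ge i (d + 1) with hi | hi
    · have : stdVec F d i = Pi.single (⟨i, hi⟩ : Fin (d + 1)) 1 := by
        ext k
        simp [stdVec, Pi.single_apply, Fin.ext_iff]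
      rw [this, Module.Basis.equivFun_symm_apply]
      simp [Pi.single_apply, he]
    · rw [stdVec_eq_zero d i (by omega), hu i (by omega), map_zero]
  have hext : ∀ f g : (Fin (d + 1) → F) →ₗ[F] V, (∀ i, f (stdVec F d i) = g (stdVec F d i)) →
      f = g := by
    intro f g hfg
    refine LinearMap.pi_ext' fun i => LinearMap.ext_ring ?_
    have : stdVec F d i = Pi.single i 1 := by
      ext k
      simp [stdVec, Pi.single_apply, Fin.ext_iff]
    simpa [this] using hfg i
  refine ⟨a, b, c, e.equivFun.symm, hκ, fun x => ?_, fun x => ?_⟩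
  · have := hext (e.equivFun.symm.toLinearMap ∘ₗ (matX d a).mulVecLin)
      (X ∘ₗ e.equivFun.symm.toLinearMap) (fun i => by
        simp only [LinearMap.comp_apply, Matrix.mulVecLin_apply, LinearEquiv.coe_coe, matX_mulVec,
          map_add, map_smul, hE, hX])
    exact congrArg (fun f => f x) this
  · have := hext (e.equivFun.symm.toLinearMap ∘ₗ (matY d a b c).mulVecLin)
      (Y ∘ₗ e.equivFun.symm.toLinearMap) (fun i => by
        rcases i with _ | i
        · simp only [LinearMap.comp_apply, Matrix.mulVecLin_apply, LinearEquiv.coe_coe,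
            matY_mulVec_zero, map_smul, hE, hY0]
        · simp only [LinearMap.comp_apply, Matrix.mulVecLin_apply, LinearEquiv.coe_coe,
            matY_mulVec_succ d hd, map_add, map_smul, hE, hY]
          rcases Nat.lt_or_ge i (d + 1) with hi | hi
          · rw [← hphi (i + 1) (by omega), hφs]
          · rw [hu i (by omega), smul_zero, smul_zero])
    exact congrArg (fun f => f x) this

end IsTriple

end Split

/-! ### Chains of vectors built from a common eigenvector of Y and X + Z. -/

section Chain

variable {F : Type*} [Field F] [CharZero F] {V : Type*} [AddCommGroup V] [Module F V]

/-- The universal property of `O_d(a,b,c)`. -/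
theorem IsTriple.Y_chain {X Y Z : Module.End F V} {d : ℕ} {a b c l : F}
    (h : IsTriple X Y Z (2 * a * b - c * (d + 1)) l (2 * c * a - b * (d + 1))) {u : ℕ → V}
    (hX : ∀ i, X (u i) = theta d a i • u i + u (i + 1)) (hY : Y (u 0) = theta d b 0 • u 0)
    (hs : X (u 0) + Z (u 0) = (a + c) • u 0) (i : ℕ) :
    Y (u (i + 1)) = theta d b (i + 1) • u (i + 1) + phi d a b c (i + 1) • u i := by
  -- The eigenvalue a + c of X + Z determines φ_1 through κ; afterwards `YXX` propagates the
  -- formula. The u_i may be dependent or zero.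
  have h0 : Y (u 1) = theta d b 1 • u 1 + phi d a b c 1 • u 0 := by
    have k := h.kappa (u 0)
    simp only [hX, hY, map_add, map_smul] at k hs
    linear_combination (norm := skip) k + hs
    match_scalars <;> simp [theta, phi] <;> ring
  induction i using Nat.twoStepInduction with
  | zero => exact h0
  | one =>
    have k := h.YXX (u 0)
    simp only [hX, hY, h0, map_add, map_smul] at k
    linear_combination (norm := skip) k
    match_scalars <;> simp [theta, phi] <;> ring
  | more i h0 h1 =>
    have k := h.YXX (u (i + 1))
    simp only [hX, h0, h1, map_add, map_smul] at k
    linear_combination (norm := skip) k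
    rcases Nat.even_or_odd i with h | h
    · have e1 : (-1 : F) ^ i = 1 := h.neg_one_pow
      match_scalars <;> simp [theta, phi, Nat.even_add_one, pow_succ, h, e1] <;> ring
    · have e1 : (-1 : F) ^ i = -1 := h.neg_one_pow
      have h2 : ¬ Even i := Nat.not_even_iff_odd.mpr h
      match_scalars <;> simp [theta, phi, Nat.even_add_one, pow_succ, h2, e1] <;> ring

end Chain

/-! ### Nonvanishing of φ, the parameter set, and traces. -/

section Parameters

variable {F : Type*} [Field F] [CharZero F]

/-- An even i gives the excluded value of a + b + c with index i. An odd i gives that of -a - b + c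
with index d + 1 - i, which is even because d is. -/
theorem phi_ne_zero_iff (d : ℕ) (hd : Even d) (a b c : F) :
    (∀ i, 1 ≤ i → i ≤ d → phi d a b c i ≠ 0) ↔
      a + b + c ∉ excluded F d ∧ -a - b + c ∉ excluded F d := by
  constructor
  · intro h
    constructor
    · rintro ⟨i, hi, h2, hid, he⟩
      apply h i (by omega) hid
      rw [phi, if_pos hi]
      linear_combination -(i : F) * he
    · rintro ⟨i, hi, h2, hid, he⟩
      have hodd : ¬ Even (d + 1 - i) := by
        rw [Nat.not_even_iff_odd]
        exact Nat.Odd.sub_even (by omega) hd.add_one hi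
      apply h (d + 1 - i) (by omega) (by omega)
      rw [phi, if_neg hodd, Nat.cast_sub (by omega)]
      push_cast
      linear_combination -(i : F) * he
  · rintro ⟨h1, h2⟩ i hi hid h0
    rcases Nat.even_or_odd i with he | ho
    · rw [phi, if_pos he] at h0
      have hi0 : (i : F) ≠ 0 := Nat.cast_ne_zero.mpr (by omega)
      have : (d : F) + 1 - 2 * i - 2 * a - 2 * b - 2 * c = 0 := by simpa [hi0] using h0
      exact h1 ⟨i, he, by rcases he with ⟨k, rfl⟩; omega, hid, by linear_combination -this / 2⟩
    · rw [phi, if_neg (Nat.not_even_iff_odd.mpr ho)] at h0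
      have hi0 : (i : F) - d - 1 ≠ 0 := by
        have : ((d + 1 - i : ℕ) : F) ≠ 0 := Nat.cast_ne_zero.mpr (by omega)
        rw [Nat.cast_sub (by omega)] at this
        push_cast at this
        exact fun hc => this (by linear_combination -hc)
      have : (d : F) + 1 - 2 * i - 2 * a - 2 * b + 2 * c = 0 := by simpa [hi0] using h0
      refine h2 ⟨d + 1 - i, Nat.Odd.sub_odd hd.add_one ho, ?_, by omega, ?_⟩
      · rcases hd with ⟨k, rfl⟩; rcases ho with ⟨j, rfl⟩; omega
      · rw [Nat.cast_sub (by omega)]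
        push_cast
        linear_combination this / 2

/-- Changing the signs of b and c turns a + b + c and -a - b + c into the other two linear forms. -/
theorem mem_OP_iff (d : ℕ) (hd : Even d) (a b c : F) :
    (a, b, c) ∈ OP F d ↔ (∀ i, 1 ≤ i → i ≤ d → phi d a b c i ≠ 0) ∧
      (∀ i, 1 ≤ i → i ≤ d → phi d a (-b) (-c) i ≠ 0) := by
  rw [phi_ne_zero_iff d hd, phi_ne_zero_iff d hd]
  simp only [OP, Set.mem_ofPred_eq, sub_neg_eq_add, ← sub_eq_add_neg]
  tauto

/-- Consecutive terms pair off to -1, so y survives only when n is odd. -/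
theorem sum_alternating (y : F) (n : ℕ) :
    ∑ i ∈ Finset.range n, (-1) ^ i * (y + (i : F)) =
      if Even n then -(n : F) / 2 else y + ((n : F) - 1) / 2 := by
  induction n with
  | zero => simp
  | succ n ih =>
    rw [Finset.sum_range_succ, ih]
    rcases Nat.even_or_odd n with h | h
    · simp [h, Nat.even_add_one, h.neg_one_pow]; ring
    · have h2 : ¬ Even n := Nat.not_even_iff_odd.mpr h
      simp [h2, Nat.even_add_one, h.neg_one_pow]; ring

theorem trace_matX (d : ℕ) (hd : Even d) (a : F) : (matX d a).trace = a := by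
  have : (matX d a).trace = ∑ i ∈ Finset.range (d + 1), (-1) ^ i * ((a - d / 2) + (i : F)) := by
    rw [Matrix.trace, Finset.sum_range]
    exact Finset.sum_congr rfl fun i _ => by simp [matX, theta_eq]
  have h2 : ¬ Even (d + 1) := by simpa [Nat.even_add_one] using hd
  rw [this, sum_alternating, if_neg h2]
  push_cast; ring

theorem trace_matY (d : ℕ) (hd : Even d) (a b c : F) : (matY d a b c).trace = b := by
  refine Eq.trans ?_ (trace_matX d hd b)
  exact Finset.sum_congr rfl fun i _ => by simp [matX, matY]

end Parameters

/-! ### The explicit matrices: the triple, generation, triangularity. -/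

section Matrices

variable {F : Type*} [Field F]

theorem isTriple_mat [CharZero F] (d : ℕ) (hd : Even d) (a b c : F) :
    IsTriple (matX d a).mulVecLin (matY d a b c).mulVecLin (matZ d a b c).mulVecLin
      (2 * a * b - c * (d + 1)) (2 * b * c - a * (d + 1)) (2 * c * a - b * (d + 1)) := by
  have hs : ∀ (r : F) (v : Fin (d + 1) → F),
      (Matrix.scalar (Fin (d + 1)) r).mulVec v = r • v := by
    intro r v
    simp [← Matrix.smul_one_eq_diagonal, Matrix.smul_mulVec]
  constructor <;> intro v <;> simp only [Matrix.mulVecLin_apply, Matrix.mulVec_mulVec,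
    ← Matrix.add_mulVec, ← Matrix.sub_mulVec]
  · rw [mat_kappa, hs]
  · rw [mat_lambda d hd, hs]
  · rw [mat_mu d hd, hs]

theorem matX_mulVec_succ_apply (d : ℕ) (a : F) (x : Fin (d + 1) → F) (i : Fin d) :
    (matX d a).mulVec x i.succ = theta d a (i + 1) * x i.succ + x i.castSucc := by
  rw [Matrix.mulVec, dotProduct, Finset.sum_eq_add i.succ i.castSucc]
  · simp [matX]
  · exact fun h => by simpa using congrArg Fin.val h
  · intro j _ hj
    have h1 : ¬ (i : ℕ) + 1 = j := fun h => hj.1 (Fin.ext (by simpa using h.symm))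
    have h2 : ¬ (i : ℕ) = j := fun h => hj.2 (Fin.ext (by simpa using h.symm))
    simp [matX, h1, h2]
  · simp
  · simp

theorem matY_mulVec_castSucc_apply (d : ℕ) (a b c : F) (x : Fin (d + 1) → F) (i : Fin d) :
    (matY d a b c).mulVec x i.castSucc
      = theta d b i * x i.castSucc + phi d a b c (i + 1) * x i.succ := by
  rw [Matrix.mulVec, dotProduct, Finset.sum_eq_add i.castSucc i.succ]
  · simp [matY]
  · exact fun h => by simpa using congrArg Fin.val h
  · intro j _ hj
    have h1 : ¬ (i : ℕ) = j := fun h => hj.1 (Fin.ext (by simpa using h.symm))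
    have h2 : ¬ (j : ℕ) = i + 1 := fun h => hj.2 (Fin.ext (by simpa using h))
    simp [matY, h1, h2]
  · simp
  · simp

theorem mem_of_stdVec_mem (d : ℕ) {W : Submodule F (Fin (d + 1) → F)}
    (h : ∀ i ≤ d, stdVec F d i ∈ W) : W = ⊤ := by
  rw [eq_top_iff]
  intro x _
  have : x = ∑ i : Fin (d + 1), x i • stdVec F d i := by
    ext j
    simp [stdVec, Finset.sum_apply, ← Fin.ext_iff]
  rw [this]
  exact Submodule.sum_mem _ fun i _ => Submodule.smul_mem _ _ (h i (by omega))

theorem generates_stdVec_zero (d : ℕ) (a : F) (Y : Module.End F (Fin (d + 1) → F)) :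
    Generates (matX d a).mulVecLin Y (stdVec F d 0) := by
  intro W hX _ h0
  refine mem_of_stdVec_mem d fun i _ => ?_
  induction i with
  | zero => exact h0
  | succ i ih =>
    have h1 := ih (by omega)
    have h2 := Submodule.sub_mem _ (hX _ h1) (Submodule.smul_mem _ (theta d a i) h1)
    rwa [Matrix.mulVecLin_apply, matX_mulVec, add_sub_cancel_left] at h2

theorem generates_stdVec_last (d : ℕ) (hd : Even d) (a b c : F)
    (X : Module.End F (Fin (d + 1) → F))
    (hφ : ∀ i, 1 ≤ i → i ≤ d → phi d a b c i ≠ 0) :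
    Generates X (matY d a b c).mulVecLin (stdVec F d d) := by
  intro W _ hY h0
  have key : ∀ k ≤ d, stdVec F d (d - k) ∈ W := by
    intro k
    induction k with
    | zero => exact fun _ => h0
    | succ k ih =>
      intro hk
      obtain ⟨i, hi⟩ : ∃ i, d - k = i + 1 := ⟨d - k - 1, by omega⟩
      have h1 := ih (by omega)
      rw [hi] at h1
      have h2 := Submodule.sub_mem _ (hY _ h1) (Submodule.smul_mem _ (theta d b (i + 1)) h1)
      rw [Matrix.mulVecLin_apply, matY_mulVec_succ d hd, add_sub_cancel_left] at h2
      rw [show d - (k + 1) = i by omega]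
      exact (Submodule.smul_mem_iff _ (hφ (i + 1) (by omega) (by omega))).mp h2
  refine mem_of_stdVec_mem d fun i hi => ?_
  have := key (d - i) (by omega)
  rwa [show d - (d - i) = i by omega] at this

/-- If the module is irreducible then no `φ_i` vanishes. -/
theorem phi_ne_zero_of_isIrred (d : ℕ) (hd : Even d) (a b c : F)
    (h : IsIrred (matX d a).mulVecLin (matY d a b c).mulVecLin) (i : ℕ) (h1 : 1 ≤ i)
    (hi : i ≤ d) : phi d a b c i ≠ 0 := by
  intro h0
  obtain ⟨i, rfl⟩ : ∃ k, i = k + 1 := ⟨i - 1, by omega⟩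
  -- If φ_{i+1} = 0, then Y cannot lead from v_{i+1} down to v_i, so v_{i+1}, …, v_d span a proper
  -- nonzero invariant subspace.
  set W : Submodule F (Fin (d + 1) → F) := Submodule.span F (stdVec F d '' Set.Ioi i) with hW
  have hmem : ∀ j, i < j → stdVec F d j ∈ W := fun j hj => Submodule.subset_span ⟨j, hj, rfl⟩
  have hle : ∀ W' : Submodule F (Fin (d + 1) → F), (∀ j, i < j → stdVec F d j ∈ W') → W ≤ W' := by
    intro W' hW'
    rw [hW, Submodule.span_le]
    rintro _ ⟨j, hj, rfl⟩
    exact hW' j hj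
  have hX : W ≤ W.comap (matX d a).mulVecLin := hle _ fun j hj => by
    rw [Submodule.mem_comap, Matrix.mulVecLin_apply, matX_mulVec]
    exact Submodule.add_mem _ (Submodule.smul_mem _ _ (hmem j hj)) (hmem (j + 1) (by omega))
  have hY : W ≤ W.comap (matY d a b c).mulVecLin := hle _ fun j hj => by
    obtain ⟨j, rfl⟩ : ∃ k, j = k + 1 := ⟨j - 1, by omega⟩
    rw [Submodule.mem_comap, Matrix.mulVecLin_apply, matY_mulVec_succ d hd]
    refine Submodule.add_mem _ (Submodule.smul_mem _ _ (hmem _ hj)) ?_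
    rcases Nat.lt_or_ge i j with hij | hij
    · exact Submodule.smul_mem _ _ (hmem j hij)
    · rw [show j = i by omega, h0, zero_smul]
      exact Submodule.zero_mem _
  rcases h W (fun w hw => hX hw) (fun w hw => hY hw) with hb | ht
  · have := hmem (i + 1) (by omega)
    rw [hb, Submodule.mem_bot] at this
    have := congrFun this ⟨i + 1, by omega⟩
    simp [stdVec] at this
  · have h2 : W ≤ LinearMap.ker (LinearMap.proj (R := F) (φ := fun _ : Fin (d + 1) => F) 0) :=
      hle _ fun j hj => by
        simp [stdVec, show ¬ 0 = j by omega]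
    rw [ht] at h2
    have := h2 (Submodule.mem_top (x := stdVec F d 0))
    simp [stdVec] at this

theorem charpoly_matX (d : ℕ) (a : F) :
    (matX d a).charpoly = ∏ i ∈ Finset.range (d + 1), (Polynomial.X - Polynomial.C (theta d a i)) := by
  rw [← Matrix.charpoly_transpose, Matrix.charpoly_of_isUpperTriangular, Finset.prod_range]
  · exact Finset.prod_congr rfl fun i _ => by simp [matX]
  · intro i j hij
    have h1 : ¬ (j : ℕ) = i := fun h => hij.ne (Fin.ext h)
    have h2 : ¬ (j : ℕ) = i + 1 := fun h => by
      have : (j : ℕ) < i := hij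
      omega
    simp [matX, h1, h2]

theorem charpoly_matY (d : ℕ) (a b c : F) :
    (matY d a b c).charpoly =
      ∏ i ∈ Finset.range (d + 1), (Polynomial.X - Polynomial.C (theta d b i)) := by
  rw [Matrix.charpoly_of_isUpperTriangular, Finset.prod_range]
  · exact Finset.prod_congr rfl fun i _ => by simp [matY]
  · intro i j hij
    have h1 : ¬ (i : ℕ) = j := fun h => hij.ne' (Fin.ext h)
    have h2 : ¬ (j : ℕ) = i + 1 := fun h => by
      have : (j : ℕ) < i := hij
      omega
    simp [matY, h1, h2]

end Matrices

/-! ### Chains with prescribed shifts. -/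

section ShiftedChain

variable {F : Type*} [Field F] {V : Type*} [AddCommGroup V] [Module F V]

/-- The vectors `(f - r_{n-1}) ⋯ (f - r_0) v`. -/
def shiftChain (f : Module.End F V) (r : ℕ → F) (v : V) : ℕ → V
  | 0 => v
  | n + 1 => f (shiftChain f r v n) - r n • shiftChain f r v n

theorem map_shiftChain (f : Module.End F V) (r : ℕ → F) (v : V) (n : ℕ) :
    f (shiftChain f r v n) = r n • shiftChain f r v n + shiftChain f r v (n + 1) := by
  rw [shiftChain]; abel

theorem shiftChain_eq_aeval (f : Module.End F V) (r : ℕ → F) (v : V) (n : ℕ) :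
    shiftChain f r v n =
      Polynomial.aeval f (∏ i ∈ Finset.range n, (Polynomial.X - Polynomial.C (r i))) v := by
  induction n with
  | zero => simp [shiftChain]
  | succ n ih =>
    rw [Finset.prod_range_succ, mul_comm, map_mul, Module.End.mul_apply, ← ih, shiftChain]
    simp

theorem shiftChain_mem (f : Module.End F V) (r : ℕ → F) (v : V) {W : Submodule F V}
    (hf : ∀ w ∈ W, f w ∈ W) (hv : v ∈ W) (n : ℕ) : shiftChain f r v n ∈ W := by
  induction n with
  | zero => exact hv
  | succ n ih => exact Submodule.sub_mem _ (hf _ ih) (Submodule.smul_mem _ _ ih)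

theorem shiftChain_mulVecLin_eq_zero {n : ℕ} (M : Matrix (Fin n) (Fin n) F) (r : ℕ → F)
    (hM : M.charpoly = ∏ i ∈ Finset.range n, (Polynomial.X - Polynomial.C (r i)))
    (v : Fin n → F) : shiftChain M.mulVecLin r v n = 0 := by
  rw [shiftChain_eq_aeval, ← hM, ← Matrix.charpoly_mulVecLin, LinearMap.aeval_self_charpoly]
  rfl

end ShiftedChain

/-! ### The irreducibility criterion. -/

section Irreducibility

variable {F : Type*} [Field F]

/-- The difference of the κ and λ relations says that {Y + 1/2, X - Z} is a scalar, so Y² + Y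
commutes with X - Z. The hypothesis on r makes each pair of consecutive factors equal to Y² + Y plus
a constant. -/
theorem IsTriple.sub_shiftChain {V : Type*} [AddCommGroup V] [Module F V]
    {X Y Z : Module.End F V} {κ l m : F} (h : IsTriple X Y Z κ l m) {r : ℕ → F}
    (hr : ∀ k, r (2 * k + 1) = -1 - r (2 * k)) {v : V} {p q : F}
    (hv : X v - Z v = p • v + q • Y v) (k : ℕ) :
    X (shiftChain Y r v (2 * k)) - Z (shiftChain Y r v (2 * k)) =
      p • shiftChain Y r v (2 * k) + q • Y (shiftChain Y r v (2 * k)) := by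
  induction k with
  | zero => exact hv
  | succ k ih =>
    set w := shiftChain Y r v (2 * k) with hw
    have e : shiftChain Y r v (2 * (k + 1)) = Y (Y w) + Y w + (r (2 * k) * (-1 - r (2 * k))) • w := by
      rw [show 2 * (k + 1) = 2 * k + 1 + 1 by ring, shiftChain, shiftChain, ← hw, hr]
      simp only [map_sub, map_smul]
      module
    have k1 := congrArg Y (h.kappa w)
    have k2 := h.kappa (Y w)
    have l1 := congrArg Y (h.lambda w)
    have l2 := h.lambda (Y w)
    have i1 := congrArg Y ih
    have i2 := congrArg Y i1
    rw [e]
    simp only [map_sub, map_smul, map_add] at *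
    linear_combination (norm := module) k2 - k1 - l2 + l1 + i2 + i1
      + (r (2 * k) * (-1 - r (2 * k))) • ih

theorem Generates.mapQ {V : Type*} [AddCommGroup V] [Module F V] {X Y : Module.End F V} {v : V}
    (h : Generates X Y v) (W : Submodule F V) (hX : W ≤ W.comap X) (hY : W ≤ W.comap Y) :
    Generates (W.mapQ W X hX) (W.mapQ W Y hY) (W.mkQ v) := by
  intro U hUX hUY hv
  have := h (U.comap W.mkQ) (fun w hw => hUX _ hw) (fun w hw => hUY _ hw) hv
  rw [eq_top_iff]
  intro x _
  obtain ⟨x, rfl⟩ := W.mkQ_surjective x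
  exact (this ▸ Submodule.mem_top : x ∈ U.comap W.mkQ)

theorem theta_odd [CharZero F] (d : ℕ) (a : F) (k : ℕ) :
    theta d a (2 * k + 1) = -1 - theta d a (2 * k) := by
  rw [theta_eq, theta_eq, pow_succ, (even_two_mul k).neg_one_pow]
  push_cast; ring

theorem add_stdVec_zero [CharZero F] (d : ℕ) (hd : Even d) (a b c : F) :
    (matX d a).mulVecLin (stdVec F d 0) + (matZ d a b c).mulVecLin (stdVec F d 0)
      = (a + c) • stdVec F d 0 := by
  simp only [Matrix.mulVecLin_apply, matZ_mulVec, matX_mulVec, matY_mulVec_zero,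
    matY_mulVec_succ d hd, Matrix.mulVec_add, Matrix.mulVec_smul]
  match_scalars <;> simp [theta, phi] <;> ring

theorem sub_stdVec_last [CharZero F] (d : ℕ) (hd : Even d) (a b c : F) :
    (matX d a).mulVecLin (stdVec F d d) - (matZ d a b c).mulVecLin (stdVec F d d)
      = (a - c + theta d b d) • stdVec F d d
        + (-1 : F) • (matY d a b c).mulVecLin (stdVec F d d) := by
  rcases d with _ | d
  · simp only [Matrix.mulVecLin_apply, matZ_mulVec, matX_mulVec, matY_mulVec_zero,
      Matrix.mulVec_smul, stdVec_eq_zero 0 (0 + 1) (by omega), add_zero]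
    match_scalars
    simp [theta]
    ring
  · have h0 : Odd d := by rwa [Nat.even_add_one, Nat.not_even_iff_odd] at hd
    simp only [Matrix.mulVecLin_apply, matZ_mulVec, matX_mulVec, matY_mulVec_succ _ hd,
      Matrix.mulVec_add, Matrix.mulVec_smul, stdVec_eq_zero (d + 1) (d + 1 + 1) (by omega),
      add_zero]
    have h1 : ¬ Even d := Nat.not_even_iff_odd.mpr h0
    match_scalars <;> simp [theta, phi, pow_succ, h0.neg_one_pow, Nat.even_add_one, h1] <;> ring

/-- The subdiagonal entries are 1, so an eigenvector is determined by its last coordinate;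
eigenspaces of X are at most one-dimensional. -/
theorem eq_zero_of_eigenvector_matX (d : ℕ) (a r : F) (x : Fin (d + 1) → F)
    (hx : (matX d a).mulVec x = r • x) (h0 : x (Fin.last d) = 0) : x = 0 := by
  funext i
  induction i using Fin.reverseInduction with
  | last => exact h0
  | cast i ih =>
    have := congrFun hx i.succ
    rw [matX_mulVec_succ_apply, Pi.smul_apply, ih] at this
    simpa using this

/-- After k steps from v_d the lowest index reached is d - k, with coefficient the product of the
φ's passed on the way. -/
theorem shiftChain_stdVec_last_apply (d : ℕ) (a b c : F) (r : ℕ → F)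
    (hφ : ∀ i, 1 ≤ i → i ≤ d → phi d a b c i ≠ 0) (k : ℕ) (j : Fin (d + 1)) :
    ((j : ℕ) + k < d → shiftChain (matY d a b c).mulVecLin r (stdVec F d d) k j = 0) ∧
    ((j : ℕ) + k = d → shiftChain (matY d a b c).mulVecLin r (stdVec F d d) k j ≠ 0) := by
  induction k generalizing j with
  | zero =>
    constructor
    · intro hj
      simp only [shiftChain, stdVec]
      rw [if_neg (by omega)]
    · intro hj
      simp only [shiftChain, stdVec]
      rw [if_pos (by omega)]
      exact one_ne_zero
  | succ k ih =>
    have step : ∀ i : Fin d, shiftChain (matY d a b c).mulVecLin r (stdVec F d d) (k + 1) i.castSucc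
        = theta d b i * shiftChain (matY d a b c).mulVecLin r (stdVec F d d) k i.castSucc
          + phi d a b c (i + 1) * shiftChain (matY d a b c).mulVecLin r (stdVec F d d) k i.succ
          - r k * shiftChain (matY d a b c).mulVecLin r (stdVec F d d) k i.castSucc := by
      intro i
      rw [shiftChain, Pi.sub_apply, Matrix.mulVecLin_apply, matY_mulVec_castSucc_apply]
      rfl
    have cast : ∀ hj : (j : ℕ) < d, j = Fin.castSucc ⟨j, hj⟩ := fun _ => rfl
    constructor
    · intro hj
      rw [cast (by omega), step, (ih _).1 (by simp; omega), (ih _).1 (by simp; omega)]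
      simp
    · intro hj
      rw [cast (by omega), step, (ih _).1 (by simp; omega), mul_zero, mul_zero, zero_add, sub_zero]
      exact mul_ne_zero (hφ _ (by simp) (by simp; omega)) ((ih _).2 (by simp; omega))

/-- A common eigenvector of `Y` and `X - Z` that generates `O_d(a,b,c)`. -/
theorem exists_lowest_vector [CharZero F] (d : ℕ) (hd : Even d) (a b c : F)
    (h1 : ∀ i, 1 ≤ i → i ≤ d → phi d a b c i ≠ 0)
    (h2 : ∀ i, 1 ≤ i → i ≤ d → phi d a (-b) (-c) i ≠ 0) :
    ∃ t : Fin (d + 1) → F, (-(matY d a b c).mulVecLin) t = (-b - d / 2) • t ∧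
      (matX d a).mulVecLin t + (-(matZ d a b c).mulVecLin) t = (a - c) • t ∧
      Generates (matX d a).mulVecLin (matY d a b c).mulVecLin t := by
  set X := (matX d a).mulVecLin with hX
  set Y := (matY d a b c).mulVecLin with hY
  set Z := (matZ d a b c).mulVecLin with hZ
  have htr : IsTriple X Y Z _ _ _ := isTriple_mat d hd a b c
  -- Applying (Y - θ*_{d-1}) ⋯ (Y - θ*_0) to v_d gives a θ*_d-eigenvector of Y by Cayley–Hamilton.
  -- As d is even the factors pair up, which makes t an eigenvector of X - Z too.
  set t := shiftChain Y (theta d b) (stdVec F d d) d with ht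
  have hθd : theta d b d = b + d / 2 := by rw [theta_eq, hd.neg_one_pow]; ring
  have hYt : Y t = theta d b d • t := by
    rw [ht, map_shiftChain,
      shiftChain_mulVecLin_eq_zero _ _ (charpoly_matY d a b c), add_zero]
  have hY' : (-Y) t = (-b - d / 2) • t := by
    rw [LinearMap.neg_apply, hYt, hθd]; module
  have hR : X t + (-Z) t = (a - c) • t := by
    obtain ⟨k, hk⟩ := hd.two_dvd
    have := htr.sub_shiftChain (theta_odd d b) (sub_stdVec_last d hd a b c) k
    rw [← hk, ← ht, hYt] at this
    rw [LinearMap.neg_apply]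
    linear_combination (norm := module) this
  refine ⟨t, hY', hR, ?_⟩
  have ht0 : t ≠ 0 := fun h0 =>
    (shiftChain_stdVec_last_apply d a b c (theta d b) h1 d 0).2 (by simp) (congrFun h0 0)
  -- For (X, -Y, -Z) the vector t plays the role of v_0 with parameters (a, -b, -c). The chain it
  -- starts is nonzero up to index d because the φ_i(a,-b,-c) are.
  have htr' : IsTriple X (-Y) (-Z) (2 * a * (-b) - (-c) * (d + 1)) (2 * b * c - a * (d + 1))
      (2 * (-c) * a - (-b) * (d + 1)) := by
    convert htr.neg using 1 <;> ring
  have hchain := htr'.Y_chain (u := shiftChain X (theta d a) t)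
    (fun i => map_shiftChain X (theta d a) t i)
    (by
      rw [shiftChain, hY']
      congr 1
      rw [theta_eq]; simp)
    (by rw [shiftChain, hR, sub_eq_add_neg])
  have hne : ∀ i ≤ d, shiftChain X (theta d a) t i ≠ 0 := by
    intro i
    induction i with
    | zero => exact fun _ => ht0
    | succ i ih =>
      intro hi h0
      have := hchain i
      rw [h0, map_zero, smul_zero, zero_add] at this
      exact (smul_ne_zero (h2 (i + 1) (by omega) hi) (ih (by omega))) this.symm
  set x := shiftChain X (theta d a) t d with hx
  have hXx : X x = theta d a d • x := by
    rw [hx, map_shiftChain, shiftChain_mulVecLin_eq_zero _ _ (charpoly_matX d a), add_zero]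
  -- The end of the chain lies in the θ_d-eigenspace of X, which is spanned by v_d. So t generates
  -- v_d, and v_d generates everything as the φ_i(a,b,c) are nonzero.
  have hxv : x = x (Fin.last d) • stdVec F d d := by
    rw [← sub_eq_zero]
    refine eq_zero_of_eigenvector_matX d a (theta d a d) _ ?_ ?_
    · rw [Matrix.mulVec_sub, Matrix.mulVec_smul, matX_mulVec,
        stdVec_eq_zero d (d + 1) (by omega), add_zero]
      rw [hX, Matrix.mulVecLin_apply] at hXx
      rw [hXx]
      module
    · simp [stdVec]
  intro W hWX hWY htW
  refine generates_stdVec_last d hd a b c X h1 W hWX hWY ?_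
  have hxW : x ∈ W := shiftChain_mem X _ t hWX htW d
  have hx0 : x (Fin.last d) ≠ 0 := fun h0 => hne d le_rfl (by
    rw [← hx, hxv, h0, zero_smul])
  rw [hxv] at hxW
  exact (Submodule.smul_mem_iff _ hx0).mp hxW

/-- Let n be the dimension of a quotient. It is generated by the images of v_0 and of t, and
`trace_Y` computes tr Y from the first and tr(-Y) from the second. For n even both equal -n/2, so n
= 0. For n odd they sum to n - 1 - d, so n = d + 1. -/
theorem isIrred_of_phi_ne_zero [CharZero F] (d : ℕ) (hd : Even d) (a b c : F)
    (h1 : ∀ i, 1 ≤ i → i ≤ d → phi d a b c i ≠ 0)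
    (h2 : ∀ i, 1 ≤ i → i ≤ d → phi d a (-b) (-c) i ≠ 0) :
    IsIrred (matX d a).mulVecLin (matY d a b c).mulVecLin := by
  obtain ⟨t, hYt, hRt, hgt⟩ := exists_lowest_vector d hd a b c h1 h2
  have hg0 := generates_stdVec_zero d a (matY d a b c).mulVecLin
  have hR0 := add_stdVec_zero d hd a b c
  have hY0 : (matY d a b c).mulVecLin (stdVec F d 0) = (b - d / 2) • stdVec F d 0 := by
    rw [Matrix.mulVecLin_apply, matY_mulVec_zero, theta_eq]; simp
  have htr := isTriple_mat d hd a b c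
  set X := (matX d a).mulVecLin
  set Y := (matY d a b c).mulVecLin
  set Z := (matZ d a b c).mulVecLin
  intro W hX hY
  have hZ : W ≤ W.comap Z := fun w hw => by
    rw [Submodule.mem_comap, htr.Z_apply]
    exact Submodule.sub_mem _ (Submodule.add_mem _ (hX _ (hY _ hw)) (hY _ (hX _ hw)))
      (Submodule.smul_mem _ _ hw)
  have htrQ := htr.mapQ W hX hY hZ
  have e1 := htrQ.trace_Y (v := W.mkQ (stdVec F d 0)) (y := b - d / 2) (s := a + c)
    (by simpa using congrArg W.mkQ hY0) (by simpa using congrArg W.mkQ hR0) (hg0.mapQ W hX hY)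
  have e2 := htrQ.neg.trace_Y (v := W.mkQ t) (y := -b - d / 2) (s := a - c)
    (by simpa using congrArg W.mkQ hYt) (by simpa using congrArg W.mkQ hRt)
    (hgt.mapQ W hX hY).neg_right
  rw [sum_alternating] at e1 e2
  rw [map_neg, e1] at e2
  have hfin := Submodule.finrank_quotient_add_finrank W
  rw [Module.finrank_fin_fun] at hfin
  split_ifs at e2 with hn
  · right
    have : (Module.finrank F ((Fin (d + 1) → F) ⧸ W) : F) = 0 := by linear_combination e2
    rw [Nat.cast_eq_zero] at this
    refine Submodule.eq_top_of_finrank_eq ?_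
    rw [Module.finrank_fin_fun]
    omega
  · left
    have : (Module.finrank F ((Fin (d + 1) → F) ⧸ W) : F) = ((d + 1 : ℕ) : F) := by
      push_cast
      linear_combination -e2
    rw [Nat.cast_inj] at this
    exact Submodule.finrank_eq_zero.mp (by omega)

theorem _root_.Matrix.trace_mulVecLin {n : Type*} [Fintype n] [DecidableEq n]
    (M : Matrix n n F) : LinearMap.trace F _ M.mulVecLin = M.trace :=
  Matrix.trace_toLin'_eq M

theorem trace_eq_of_equiv {n V : Type*} [Fintype n] [DecidableEq n] [AddCommGroup V] [Module F V]
    {M : Matrix n n F} {X : Module.End F V} (E : (n → F) ≃ₗ[F] V)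
    (h : ∀ x, E (M.mulVec x) = X (E x)) : LinearMap.trace F V X = M.trace := by
  have : X = E.conj M.mulVecLin := LinearMap.ext fun x => by
    simp [LinearEquiv.conj_apply, h]
  rw [this, LinearMap.trace_conj', Matrix.trace_mulVecLin]

theorem IsIrred.of_equiv {V V' : Type*} [AddCommGroup V] [Module F V] [AddCommGroup V']
    [Module F V'] {X Y : Module.End F V} {X' Y' : Module.End F V'} (h : IsIrred X' Y')
    (E : V ≃ₗ[F] V') (hX : ∀ x, E (X x) = X' (E x)) (hY : ∀ x, E (Y x) = Y' (E x)) :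
    IsIrred X Y := by
  intro W hWX hWY
  rcases h (W.map E.toLinearMap)
    (by rintro _ ⟨w, hw, rfl⟩; exact ⟨X w, hWX w hw, hX w⟩)
    (by rintro _ ⟨w, hw, rfl⟩; exact ⟨Y w, hWY w hw, hY w⟩) with hb | ht
  · left
    simpa using hb
  · right
    rw [← Submodule.comap_map_eq_of_injective (f := E.toLinearMap) E.injective W, ht,
      Submodule.comap_top]

/-- `O_d(a,b,c)` is irreducible precisely for `(a,b,c)` in the parameter set. -/
theorem isIrred_iff_mem_OP [IsAlgClosed F] [CharZero F] (d : ℕ) (hd : Even d) (a b c : F) :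
    IsIrred (matX d a).mulVecLin (matY d a b c).mulVecLin ↔ (a, b, c) ∈ OP F d := by
  rw [mem_OP_iff d hd]
  refine ⟨fun h => ⟨phi_ne_zero_of_isIrred d hd a b c h, ?_⟩,
    fun h => isIrred_of_phi_ne_zero d hd a b c h.1 h.2⟩
  have htr := (isTriple_mat d hd a b c).neg
  -- The negated triple is again irreducible, hence given by some O_d(a',b',c'). The traces and κ
  -- identify the parameters as (a, -b, -c), so the φ_i(a,-b,-c) are nonzero as well.
  obtain ⟨a', b', c', E, hκ, hEX, hEY⟩ := htr.exists_equiv h.neg_right hd (by simp)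
  have ea : a' = a := by
    rw [← trace_matX d hd a', ← trace_eq_of_equiv E hEX, Matrix.trace_mulVecLin, trace_matX d hd]
  have eb : b' = -b := by
    rw [← trace_matY d hd a' b' c', ← trace_eq_of_equiv E hEY, map_neg, Matrix.trace_mulVecLin,
      trace_matY d hd]
  have ec : c' = -c := by
    have hne : ((d : F) + 1) ≠ 0 := Nat.cast_add_one_ne_zero d
    rw [ea, eb] at hκ
    refine mul_right_cancel₀ hne ?_
    linear_combination hκ
  rw [← ea, ← eb, ← ec]
  exact phi_ne_zero_of_isIrred d hd a' b' c' (h.neg_right.of_equiv E hEX hEY)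

end Irreducibility

/-! ### From modules over the algebra to triples of operators. -/

section Representation

variable (F : Type*) [Field F]

/-- A generator, as an element of the universal Bannai–Ito algebra. -/
noncomputable def generator (g : Gen) : BI F := RingQuot.mkAlgHom F (Rel F) (gen F g)

theorem adjoin_generator : Algebra.adjoin F (Set.range (generator F)) = ⊤ := by
  have h1 : Set.range (generator F) =
      RingQuot.mkAlgHom F (Rel F) '' Set.range (FreeAlgebra.ι F) := by
    rw [← Set.range_comp]; rfl
  rw [h1, ← AlgHom.map_adjoin, FreeAlgebra.adjoin_range_ι, Algebra.map_top]
  exact (AlgHom.range_eq_top _).mpr (RingQuot.mkAlgHom_surjective F (Rel F))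

variable {F}

theorem generator_induction {S : Subalgebra F (BI F)} (h : ∀ g, generator F g ∈ S) (r : BI F) :
    r ∈ S := by
  have : Algebra.adjoin F (Set.range (generator F)) ≤ S :=
    Algebra.adjoin_le (by rintro _ ⟨g, rfl⟩; exact h g)
  rw [adjoin_generator] at this
  exact this Algebra.mem_top

theorem kappa_commute (g : Gen) : Commute (generator F .X * generator F .Y
    + generator F .Y * generator F .X - generator F .Z) (generator F g) := by
  have := RingQuot.mkAlgHom_rel F (Rel.kappa (F := F) g)
  simp only [map_mul, map_add, map_sub] at this
  exact this

theorem lambda_commute (g : Gen) : Commute (generator F .Y * generator F .Z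
    + generator F .Z * generator F .Y - generator F .X) (generator F g) := by
  have := RingQuot.mkAlgHom_rel F (Rel.lambda (F := F) g)
  simp only [map_mul, map_add, map_sub] at this
  exact this

theorem mu_commute (g : Gen) : Commute (generator F .Z * generator F .X
    + generator F .X * generator F .Z - generator F .Y) (generator F g) := by
  have := RingQuot.mkAlgHom_rel F (Rel.mu (F := F) g)
  simp only [map_mul, map_add, map_sub] at this
  exact this

variable {V : Type*} [AddCommGroup V] [Module (BI F) V] [Module F V] [IsScalarTower F (BI F) V]

theorem smul_mem_of_generator {W : Submodule F V} (h : ∀ g, ∀ w ∈ W, generator F g • w ∈ W)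
    (r : BI F) {w : V} (hw : w ∈ W) : r • w ∈ W := by
  let S : Subalgebra F (BI F) :=
    { carrier := {r | ∀ w ∈ W, r • w ∈ W}
      mul_mem' := fun ha hb w hw => by rw [mul_smul]; exact ha _ (hb _ hw)
      add_mem' := fun ha hb w hw => by rw [add_smul]; exact W.add_mem (ha _ hw) (hb _ hw)
      algebraMap_mem' := fun r w hw => by rw [algebraMap_smul]; exact W.smul_mem r hw }
  exact generator_induction (S := S) h r w hw

/-- A linear equivalence commuting with the generators is an isomorphism of modules over the
universal Bannai–Ito algebra. -/
noncomputable def equivOfGenerator {V' : Type*} [AddCommGroup V'] [Module (BI F) V'] [Module F V']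
    [IsScalarTower F (BI F) V'] (E : V ≃ₗ[F] V')
    (h : ∀ g x, E (generator F g • x) = generator F g • E x) : V ≃ₗ[BI F] V' :=
  { E with
    map_smul' := fun r => by
      let S : Subalgebra F (BI F) :=
        { carrier := {r | ∀ x, E (r • x) = r • E x}
          mul_mem' := fun ha hb x => by rw [mul_smul, ha, hb, mul_smul]
          add_mem' := fun ha hb x => by rw [add_smul, map_add, ha, hb, add_smul]
          algebraMap_mem' := fun r x => by rw [algebraMap_smul, map_smul, algebraMap_smul] }
      exact generator_induction (S := S) h r }

variable (F V) in
/-- The operator by which a generator acts. -/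
noncomputable def action (g : Gen) : Module.End F V := Algebra.lsmul F F V (generator F g)

theorem action_apply (g : Gen) (v : V) : action F V g v = generator F g • v := rfl

theorem eq_bot_or_eq_top_of_invariant [IsSimpleModule (BI F) V] (W : Submodule F V)
    (h : ∀ g, ∀ w ∈ W, generator F g • w ∈ W) : W = ⊥ ∨ W = ⊤ := by
  let W' : Submodule (BI F) V :=
    { W with smul_mem' := fun r _ hw => smul_mem_of_generator h r hw }
  have hW : ∀ w, w ∈ W' ↔ w ∈ W := fun _ => Iff.rfl
  rcases eq_bot_or_eq_top W' with hb | ht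
  · left
    ext w
    rw [← hW, hb, Submodule.mem_bot, Submodule.mem_bot]
  · right
    ext w
    rw [← hW, ht]
    simp

/-- Schur's lemma: z commutes with the generators, so its eigenspaces are submodules. -/
theorem exists_smul_eq_of_commute [IsAlgClosed F] [IsSimpleModule (BI F) V]
    [FiniteDimensional F V] (z : BI F) (hz : ∀ g, Commute z (generator F g)) :
    ∃ r : F, ∀ v : V, z • v = r • v := by
  have : Nontrivial V := IsSimpleModule.nontrivial (BI F) V
  obtain ⟨r, v, -, hv0, hv⟩ := exists_eigenvector_mem (Algebra.lsmul F F V z) ⊤ top_ne_bot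
    (fun _ _ => Submodule.mem_top)
  refine ⟨r, fun w => ?_⟩
  rcases eq_bot_or_eq_top_of_invariant (Module.End.eigenspace (Algebra.lsmul F F V z) r)
    (fun g w hw => by
      rw [Module.End.mem_eigenspace_iff, Algebra.lsmul_apply] at hw ⊢
      rw [← mul_smul, (hz g).eq, mul_smul, hw, smul_comm]) with hb | ht
  · have := Module.End.mem_eigenspace_iff.mpr hv
    rw [hb, Submodule.mem_bot] at this
    exact absurd this hv0
  · exact Module.End.mem_eigenspace_iff.mp (ht ▸ Submodule.mem_top (x := w))

theorem exists_isTriple [IsAlgClosed F] [IsSimpleModule (BI F) V] [FiniteDimensional F V] :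
    ∃ κ l m : F, IsTriple (action F V .X) (action F V .Y) (action F V .Z) κ l m := by
  obtain ⟨κ, hκ⟩ := exists_smul_eq_of_commute (V := V) _ (kappa_commute (F := F))
  obtain ⟨l, hl⟩ := exists_smul_eq_of_commute (V := V) _ (lambda_commute (F := F))
  obtain ⟨m, hm⟩ := exists_smul_eq_of_commute (V := V) _ (mu_commute (F := F))
  refine ⟨κ, l, m, fun v => ?_, fun v => ?_, fun v => ?_⟩
  · rw [← hκ, sub_smul, add_smul, mul_smul, mul_smul]; rfl
  · rw [← hl, sub_smul, add_smul, mul_smul, mul_smul]; rfl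
  · rw [← hm, sub_smul, add_smul, mul_smul, mul_smul]; rfl

theorem IsTriple.isIrred_action [IsSimpleModule (BI F) V] {κ l m : F}
    (h : IsTriple (action F V .X) (action F V .Y) (action F V .Z) κ l m) :
    IsIrred (action F V .X) (action F V .Y) := by
  intro W hX hY
  refine eq_bot_or_eq_top_of_invariant W fun g w hw => ?_
  cases g with
  | X => exact hX w hw
  | Y => exact hY w hw
  | Z =>
    rw [← action_apply, h.Z_apply]
    exact Submodule.sub_mem _ (Submodule.add_mem _ (hX _ (hY _ hw)) (hY _ (hX _ hw)))
      (Submodule.smul_mem _ _ hw)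

theorem isSimpleModule_of_isIrred [Nontrivial V]
    (h : IsIrred (action F V .X) (action F V .Y)) : IsSimpleModule (BI F) V := by
  refine isSimpleModule_iff _ _ |>.mpr { eq_bot_or_eq_top := fun W => ?_ }
  rcases h (W.restrictScalars F) (fun w hw => W.smul_mem _ hw) (fun w hw => W.smul_mem _ hw)
    with hb | ht
  · left; exact (Submodule.restrictScalars_eq_bot_iff _ _ _).mp hb
  · right; exact (Submodule.restrictScalars_eq_top_iff _ _ _).mp ht

theorem exists_params [IsAlgClosed F] [CharZero F] [IsSimpleModule (BI F) V] (d : ℕ)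
    (hd : Even d) (hV : Module.finrank F V = d + 1) :
    ∃ a b c : F, (a, b, c) ∈ OP F d ∧ ∃ E : (Fin (d + 1) → F) ≃ₗ[F] V,
      ∀ g x, E ((matGen d a b c g).mulVec x) = generator F g • E x := by
  have : FiniteDimensional F V := Module.finite_of_finrank_pos (by omega)
  obtain ⟨κ, l, m, h⟩ := exists_isTriple (F := F) (V := V)
  obtain ⟨a, b, c, E, hκ, hX, hY⟩ := h.exists_equiv h.isIrred_action hd hV
  refine ⟨a, b, c, ?_, E, ?_⟩
  · rw [← isIrred_iff_mem_OP d hd]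
    exact h.isIrred_action.of_equiv E hX hY
  · rintro (_ | _ | _) x
    · exact hX x
    · exact hY x
    · rw [← action_apply, h.Z_apply, hκ]
      simp only [matGen, matZ_mulVec, map_sub, map_add, map_smul, hX, hY]

end Representation

/-! ### The modules O_d(a,b,c) and recovery of their parameters. -/

section OddModule

variable {F : Type u} [Field F] [CharZero F] (d : ℕ) (hd : Even d) (a b c : F)

noncomputable instance : Module F (OddModule d hd a b c) :=
  inferInstanceAs (Module F (Fin (d + 1) → F))

theorem rep_generator (g : Gen) : rep d hd a b c (generator F g) = matGen d a b c g := by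
  rw [rep, generator, RingQuot.liftAlgHom_mkAlgHom_apply, FreeAlgebra.lift_ι_apply]

instance : IsScalarTower F (BI F) (OddModule d hd a b c) where
  smul_assoc r x v := by
    change (rep d hd a b c (r • x)).mulVec v = r • (rep d hd a b c x).mulVec v
    rw [map_smul]
    exact Matrix.smul_mulVec r _ _

/-- The coordinates of an element of `O_d(a,b,c)`. -/
noncomputable def oddEquiv : (Fin (d + 1) → F) ≃ₗ[F] ULift.{v} (OddModule d hd a b c) :=
  (LinearEquiv.refl F (Fin (d + 1) → F) : (Fin (d + 1) → F) ≃ₗ[F] OddModule d hd a b c).trans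
    ULift.moduleEquiv.symm

theorem oddEquiv_mulVec (g : Gen) (x : Fin (d + 1) → F) :
    oddEquiv.{u, v} d hd a b c ((matGen d a b c g).mulVec x)
      = generator F g • oddEquiv.{u, v} d hd a b c x := by
  rw [← rep_generator d hd]
  rfl

theorem finrank_ulift_oddModule :
    Module.finrank F (ULift.{v} (OddModule d hd a b c)) = d + 1 := by
  rw [← (oddEquiv.{u, v} d hd a b c).finrank_eq, Module.finrank_fin_fun]

theorem isIrred_action_ulift (h : IsIrred (matX d a).mulVecLin (matY d a b c).mulVecLin) :
    IsIrred (action F (ULift.{v} (OddModule d hd a b c)) Gen.X)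
      (action F (ULift.{v} (OddModule d hd a b c)) Gen.Y) := by
  have key : ∀ g x, (oddEquiv.{u, v} d hd a b c).symm
      (action F (ULift.{v} (OddModule d hd a b c)) g x)
      = (matGen d a b c g).mulVec ((oddEquiv.{u, v} d hd a b c).symm x) := fun g x => by
    rw [LinearEquiv.symm_apply_eq, oddEquiv_mulVec, LinearEquiv.apply_symm_apply, action_apply]
  exact h.of_equiv (oddEquiv.{u, v} d hd a b c).symm (key .X) (key .Y)

variable {d a b c} in
theorem params_eq_of_equiv {a' b' c' : F} (E : (Fin (d + 1) → F) ≃ₗ[F] (Fin (d + 1) → F))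
    (hd : Even d)
    (h : ∀ g x, E ((matGen d a b c g).mulVec x) = (matGen d a' b' c' g).mulVec (E x)) :
    (a, b, c) = (a', b', c') := by
  have ea : a = a' := by
    rw [← trace_matX d hd a, ← trace_matX d hd a', ← Matrix.trace_mulVecLin (matX d a')]
    exact (trace_eq_of_equiv E (h .X)).symm
  have eb : b = b' := by
    rw [← trace_matY d hd a b c, ← trace_matY d hd a' b' c',
      ← Matrix.trace_mulVecLin (matY d a' b' c')]
    exact (trace_eq_of_equiv E (h .Y)).symm
  -- An isomorphism carries the scalar κ of one module to that of the other.
  have ec : 2 * a * b - c * (d + 1) = 2 * a' * b' - c' * (d + 1) := by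
    have k1 := (isTriple_mat d hd a b c).kappa (stdVec F d 0)
    have k2 := (isTriple_mat d hd a' b' c').kappa (E (stdVec F d 0))
    have hX : ∀ x, E ((matX d a).mulVecLin x) = (matX d a').mulVecLin (E x) := h .X
    have hY : ∀ x, E ((matY d a b c).mulVecLin x) = (matY d a' b' c').mulVecLin (E x) := h .Y
    have hZ : ∀ x, E ((matZ d a b c).mulVecLin x) = (matZ d a' b' c').mulVecLin (E x) := h .Z
    have k3 := congrArg E k1
    simp only [map_sub, map_add, map_smul, hX, hY, hZ] at k3
    rw [k2] at k3
    have hne : E (stdVec F d 0) ≠ 0 := by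
      rw [E.map_ne_zero_iff]
      intro h0
      simpa [stdVec] using congrFun h0 0
    exact (smul_left_injective F hne k3).symm
  have hne : ((d : F) + 1) ≠ 0 := Nat.cast_add_one_ne_zero d
  subst ea eb
  have : c = c' := mul_right_cancel₀ hne (by linear_combination -ec)
  rw [this]

end OddModule

/-! ### Dimensions and isomorphism classes. -/

section Classes

variable {F : Type u} [Field F]

/-- An F-structure compatible with the action of the algebra is unique, so the one built into `dim`
may be replaced by any other. -/
theorem dim_eq_finrank (V : ModuleCat.{max u v} (BI F)) [inst : Module F V]
    [IsScalarTower F (BI F) V] : dim.{u, v} F V = Module.finrank F V := by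
  have : inst = Module.compHom V (algebraMap F (BI F)) :=
    Module.ext' _ _ fun r x => (algebraMap_smul (BI F) r x).symm
  rw [dim, this]

noncomputable instance [CharZero F] (d : ℕ) (hd : Even d) (a b c : F) :
    Module F (oddObj.{u, v} F d hd a b c) :=
  inferInstanceAs (Module F (ULift.{v} (OddModule d hd a b c)))

instance [CharZero F] (d : ℕ) (hd : Even d) (a b c : F) :
    IsScalarTower F (BI F) (oddObj.{u, v} F d hd a b c) :=
  inferInstanceAs (IsScalarTower F (BI F) (ULift.{v} (OddModule d hd a b c)))

theorem isoClass_eq_iff (V W : ModuleCat.{max u v} (BI F)) :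
    isoClass.{u, v} F V = isoClass.{u, v} F W ↔ Nonempty (V ≃ₗ[BI F] W) := by
  rw [isoClass, isoClass, Quotient.eq]
  exact ⟨fun ⟨e⟩ => ⟨e.toLinearEquiv⟩, fun ⟨e⟩ => ⟨e.toModuleIso⟩⟩

end Classes

end BannaiIto

/-- Over an algebraically closed field of characteristic zero and for even `d`, the map
`(a,b,c) ↦ [O_d(a,b,c)]` is a bijection from `OP_d` onto the set of isomorphism classes of
`(d+1)`-dimensional irreducible modules over the universal Bannai–Ito algebra. -/
theorem theorem2p7 (F : Type u) [Field F] [IsAlgClosed F] [CharZero F] (d : ℕ) (hd : Even d) :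
    Set.BijOn
      (fun p : F × F × F =>
        BannaiIto.isoClass.{u, v} F (BannaiIto.oddObj.{u, v} F d hd p.1 p.2.1 p.2.2))
      (BannaiIto.OP F d) (BannaiIto.OM.{u, v} F d) := by
  open BannaiIto in
  refine ⟨?_, ?_, ?_⟩
  · rintro ⟨a, b, c⟩ hp
    have hirr := isIrred_action_ulift.{u, v} d hd a b c ((isIrred_iff_mem_OP d hd a b c).mpr hp)
    have hfin := finrank_ulift_oddModule.{u, v} d hd a b c
    have : Nontrivial (ULift.{v} (OddModule d hd a b c)) :=
      Module.nontrivial_of_finrank_pos (R := F) (by omega)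
    have hsimple : IsSimpleModule (BI F) (ULift.{v} (OddModule d hd a b c)) :=
      isSimpleModule_of_isIrred hirr
    exact ⟨oddObj.{u, v} F d hd a b c, hsimple,
      (dim_eq_finrank.{u, v} (oddObj.{u, v} F d hd a b c)).trans hfin, rfl⟩
  · rintro ⟨a, b, c⟩ - ⟨a', b', c'⟩ - h
    obtain ⟨e⟩ := (isoClass_eq_iff _ _).mp h
    let e' : ULift.{v} (OddModule d hd a b c) ≃ₗ[BI F] ULift.{v} (OddModule d hd a' b' c') := e
    refine params_eq_of_equiv (((oddEquiv.{u, v} d hd a b c).trans (e'.restrictScalars F)).trans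
      (oddEquiv.{u, v} d hd a' b' c').symm) hd fun g x => ?_
    simp only [LinearEquiv.trans_apply, LinearEquiv.restrictScalars_apply]
    rw [LinearEquiv.symm_apply_eq, oddEquiv_mulVec, oddEquiv_mulVec, map_smul,
      LinearEquiv.apply_symm_apply]
  · rintro _ ⟨V, hV, hdim, rfl⟩
    -- This is the very F-structure used by `dim`, so `hdim` applies to it directly.
    let : Module F V := Module.compHom V (algebraMap F (BI F))
    have : IsScalarTower F (BI F) V := ⟨fun r x v => by
      rw [Algebra.smul_def, mul_smul]; rfl⟩
    obtain ⟨a, b, c, hp, E, hE⟩ := exists_params (V := V) d hd hdim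
    let e : ULift.{v} (OddModule d hd a b c) ≃ₗ[BI F] V :=
      equivOfGenerator ((oddEquiv.{u, v} d hd a b c).symm.trans E) fun g x => by
        obtain ⟨x, rfl⟩ := (oddEquiv.{u, v} d hd a b c).surjective x
        rw [← oddEquiv_mulVec]
        simp [hE]
    exact ⟨(a, b, c), hp, (isoClass_eq_iff _ _).mpr ⟨e⟩⟩
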